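/- **Problem.** In $k$-level UFLWP ($k\ge 1$) we are given a finite set $C$ of clients and pairwise disjoint finite sets $F_1,\dots,F_k$ of facilities, all located in a metric space (distances $c$), opening costs $f_i\ge 0$ and penalties $p_j\ge 0$. Each client $j$ is either connected by a path $(j,i_1,\dots,i_k)$, where $i_t\in F_t$ is open, at cost $c_{j i_1}+c_{i_1i_2}+\dots+c_{i_{k-1}i_k}$, or rejected at cost $p_j$. **LP.** A *vertex* is a sequence $q=(i_t,\dots,i_k)$ with $i_s\in F_s$; it is a copy of $i_t$, its father is $(i_{t+1},\dots,i_k)$, and the roots are the top-level facilities $i_k$. For a client $j$ and a path $p=(i_1,\dots,i_k)$ let $c_{jp}$ be the connection cost. The extended LP minimizes $\sum_q x_q f_{i_t}+\sum_{j,p}x_{jp}c_{jp}+\sum_j g_jp_j$ subject to $\sum_p x_{jp}+g_j\ge 1$ for all $j$; $x_{q}\le x_{\mathrm{father}(q)}$ for all non-roots $q$; $\sum_{p\ni q}x_{jp}\le x_q$ for all $j,q$; and nonnegativity. Let $F^*,C^*,P^*$ be the three parts of the cost of the optimal solution $(x^*,g^*)$ used by the algorithm. **Algorithm $A(\gamma)$.**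 (1) Take an optimal LP solution $(x^*,g^*)$. (2) Multiply facility openings and rejections by $\gamma$ and recompute a minimum-cost connection $\bar x\ge 0$ with $\sum_p\bar x_{jp}\ge\gamma(1-g^*_j)$ and $\sum_{p\ni q}\bar x_{jp}\le\gamma x^*_q$. (3) Let $C_\gamma=\{j:\gamma(1-g_j^*)\ge1\}$. The close paths of $j\in C_\gamma$ are the cheapest paths carrying one unit of the flow $\bar x_{j\cdot}$ (the last one is split if necessary); $D^C_{av}(j)$ and $D^C_{max}(j)$ are their average and maximum cost. Two clients are neighbours if close paths of theirs end in the same top-level facility. (4) Cluster $C_\gamma$ greedily: repeatedly choose an unclustered client $j$ minimizing $D^C_{av}(j)+D^C_{max}(j)$ as a center and put $j$ and its unclustered neighbours into its cluster. (5) Let $x_q=\min\{1,\gamma x^*_q\}$, put $x_{\mathrm{father}(q)}=1$ if $q$ is a root, and let $y_q$ be the amount of close flow of a cluster center through $q$. Independently, each center chooses one of its close paths with probability equal to its close flow and opens all vertices on it; all other vertices are considered from the roots downwards, and a vertex $q$ not on a chosen path is opened, if it is a root or its father is open, with probability $(x_q-y_q)/(x_{\mathrm{father}(q)}-y_q)$.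 (So each $q$ is open with probability $x_q$.) A facility is open if one of its copies is. (6) Connect each client by a cheapest open path unless rejecting it is cheaper. **Functions.** Let $f_1(z)=z$ and, for $k\ge2$, $f_k(z)=z\cdot\inf\bigl(1-\prod_{i=1}^n(1-f_{k-1}(z_i/z))\bigr)$ over all $n$ and $z_i>0$ with $\sum_i z_i=z$; let $F_k(x)=1-\sup\prod_{i=1}^n(1-f_k(x_i))$ over all $n$ and $0<x_i\le1$ with $\sum_i x_i=x$. **Claim.** Let $1<\gamma\le 3$. For a single run of $A(\gamma)$ (with any choice of the optimal solutions in (1), (2) and any tie-breaking), the expected total connection plus penalty cost satisfies $$E[C+P]\le\max\Bigl\{3-2F_k(\gamma),\ \frac{2-F_k(\gamma)-F_k(1)}{1-\frac1\gamma}\Bigr\}\,(C^*+P^*),$$ and the expected facility opening cost satisfies $E[F]\le\gamma F^*$. -/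

import Mathlib

/-! The `k`-level uncapacitated facility location problem with penalties, its extended LP
relaxation, and the LP-rounding algorithm `A(γ)`. -/

noncomputable section

namespace KLevelUFL

open scoped Classical

universe u v w

/-- An instance: clients `C` and, for each of the `k` levels `t`, the facilities `F t` of that
level (so different levels are disjoint), all located in a (pseudo)metric space `X`. The level `t`
of the mathematics is the element `t - 1` of `Fin k`. -/
structure Instance (k : ℕ) (C : Type u) (F : Fin k → Type v) (X : Type w)
    [PseudoMetricSpace X] where
  clientLoc : C → X
  facLoc : (t : Fin k) → F t → X
  openCost : (t : Fin k) → F t → ℝ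
  openCost_nonneg : ∀ t i, 0 ≤ openCost t i
  penalty : C → ℝ
  penalty_nonneg : ∀ j, 0 ≤ penalty j

/-- The facilities `(i_1, …, i_k)` of a connection path, one on each level. -/
abbrev Path {k : ℕ} (F : Fin k → Type v) : Type v := (t : Fin k) → F t

/-- The paths `(i_t, …, i_k)` from some level `t` to the highest level. They are the vertices of
the forest: `(i_t, …, i_k)` is the copy of the facility `i_t` that hangs below
`(i_{t+1}, …, i_k)`, and the trees of the forest correspond to the top-level facilities `i_k`. -/
abbrev Node {k : ℕ} (F : Fin k → Type v) : Type v :=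
  (t : Fin k) × ((s : {s : Fin k // t ≤ s}) → F s.1)

section Forest

variable {k : ℕ} {F : Fin k → Type v}

/-- The end piece `(i_t, …, i_k)` of `p = (i_1, …, i_k)`. -/
def Path.node (p : Path F) (t : Fin k) : Node F := ⟨t, fun s => p s.1⟩

/-- The forest vertex `q` lies on the path `p`. -/
def Path.Through (p : Path F) (q : Node F) : Prop := Path.node p q.1 = q

/-- The facility `i_t` of `(i_t, …, i_k)`. -/
def Node.facility (q : Node F) : F q.1 := q.2 ⟨q.1, le_rfl⟩

/-- The father `(i_{t+1}, …, i_k)` of `(i_t, …, i_k)`, for `t < k`. -/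
def Node.father (q : Node F) (h : q.1.1 + 1 < k) : Node F :=
  ⟨⟨q.1.1 + 1, h⟩, fun s => q.2 ⟨s.1,
    le_trans (show q.1 ≤ ⟨q.1.1 + 1, h⟩ from Nat.le_succ q.1.1) s.2⟩⟩

end Forest

section Costs

variable {k : ℕ} [NeZero k] {C : Type u} {F : Fin k → Type v} {X : Type w}
  [PseudoMetricSpace X]

/-- The connection cost `c(j,i_1) + c(i_1,i_2) + ⋯ + c(i_{k-1},i_k)`. -/
def Instance.pathCost (I : Instance k C F X) (j : C) (p : Path F) : ℝ :=
  dist (I.clientLoc j) (I.facLoc 0 (p 0)) +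
    ∑ t : Fin k, if h : t.1 + 1 < k then
      dist (I.facLoc t (p t)) (I.facLoc ⟨t.1 + 1, h⟩ (p ⟨t.1 + 1, h⟩)) else 0

end Costs

/-- Values of the LP variables: `conn j p` is `x_{(j, p)}`, `opening q` is `x_q` for
`q = (i_t, …, i_k)`, and `rej j` is `g_j`. -/
structure FracSol {k : ℕ} (C : Type u) (F : Fin k → Type v) where
  conn : C → Path F → ℝ
  opening : Node F → ℝ
  rej : C → ℝ

section LP

variable {k : ℕ} [NeZero k] {C : Type u} {F : Fin k → Type v} {X : Type w}
  [PseudoMetricSpace X] [Fintype C] [∀ t, Fintype (F t)]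

/-- Feasibility for the extended LP. -/
structure FracSol.Feasible (z : FracSol C F) : Prop where
  served : ∀ j, 1 ≤ ∑ p, z.conn j p + z.rej j
  opening_le_father : ∀ (q : Node F) (h : q.1.1 + 1 < k), z.opening q ≤ z.opening (q.father h)
  usage_le_opening : ∀ (j : C) (q : Node F),
    ∑ p with Path.Through p q, z.conn j p ≤ z.opening q
  conn_nonneg : ∀ j p, 0 ≤ z.conn j p
  opening_nonneg : ∀ q, 0 ≤ z.opening q
  rej_nonneg : ∀ j, 0 ≤ z.rej j

/-- The fractional facility cost. -/
def FracSol.facCost (z : FracSol C F) (I : Instance k C F X) : ℝ :=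
  ∑ q : Node F, z.opening q * I.openCost q.1 q.facility

/-- The fractional connection cost. -/
def FracSol.connCost (z : FracSol C F) (I : Instance k C F X) : ℝ :=
  ∑ j, ∑ p, z.conn j p * I.pathCost j p

/-- The fractional penalty cost. -/
def FracSol.penCost (z : FracSol C F) (I : Instance k C F X) : ℝ :=
  ∑ j, z.rej j * I.penalty j

/-- Optimality for the extended LP. -/
def FracSol.Optimal (z : FracSol C F) (I : Instance k C F X) : Prop :=
  z.Feasible ∧ ∀ z' : FracSol C F, z'.Feasible →
    z.facCost I + z.connCost I + z.penCost I ≤ z'.facCost I + z'.connCost I + z'.penCost I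

/-- `xbar` is a possible fractional connection once the facility opening and the rejection
variables of `z` have been multiplied by `γ`: client `j` has to get a flow of at least
`γ (1 - g_j)`. -/
structure ScaledConn (z : FracSol C F) (γ : ℝ) (xbar : C → Path F → ℝ) : Prop where
  nonneg : ∀ j p, 0 ≤ xbar j p
  served : ∀ j, γ ≤ ∑ p, xbar j p + γ * z.rej j
  usage_le_opening : ∀ (j : C) (q : Node F),
    ∑ p with Path.Through p q, xbar j p ≤ γ * z.opening q

/-- `xbar` is such a connection of minimum cost. -/
def Recomputed (I : Instance k C F X) (z : FracSol C F) (γ : ℝ) (xbar : C → Path F → ℝ) : Prop :=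
  ScaledConn z γ xbar ∧ ∀ x', ScaledConn z γ x' →
    ∑ j, ∑ p, xbar j p * I.pathCost j p ≤ ∑ j, ∑ p, x' j p * I.pathCost j p

/-- The set `C_γ` of the clients with `γ (1 - g_j) ≥ 1`. -/
def bigClients (z : FracSol C F) (γ : ℝ) : Finset C :=
  Finset.univ.filter fun j => 1 ≤ γ * (1 - z.rej j)

/-- `y` is the close part of the flow `x` of client `j`: paths are sorted by non-decreasing cost
and the first unit of flow is taken (the last path is split if necessary). -/
structure IsClosePart (I : Instance k C F X) (j : C) (x y : Path F → ℝ) : Prop where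
  nonneg : ∀ p, 0 ≤ y p
  le : ∀ p, y p ≤ x p
  volume : ∑ p, y p = 1
  cheapest : ∀ p p', 0 < y p → y p' < x p' → I.pathCost j p ≤ I.pathCost j p'

/-- `D_av^C(j)`: the average cost of the close paths. -/
def closeAvg (I : Instance k C F X) (close : C → Path F → ℝ) (j : C) : ℝ :=
  ∑ p, close j p * I.pathCost j p

/-- `D_max^C(j)`: the maximum cost of a close path. -/
def closeMax (I : Instance k C F X) (close : C → Path F → ℝ) (j : C) : ℝ :=
  sSup {c | ∃ p, 0 < close j p ∧ c = I.pathCost j p}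

/-- Two clients are neighbours if their close paths have a common top-level facility. -/
def Neighbor (close : C → Path F → ℝ) (j₁ j₂ : C) : Prop :=
  ∃ p₁ p₂ : Path F, 0 < close j₁ p₁ ∧ 0 < close j₂ p₂ ∧
    ∀ t : Fin k, t.1 + 1 = k → p₁ t = p₂ t

/-- The greedy clustering, as a relation: `ClusterRun I close U center` says that some run of the
loop that starts with `U` as the set of unclustered clients assigns to each `j ∈ U` the center
`center j` of its cluster. -/
inductive ClusterRun (I : Instance k C F X) (close : C → Path F → ℝ) :
    Finset C → (C → C) → Prop
  | done (center : C → C) : ClusterRun I close ∅ center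
  | step (U : Finset C) (center : C → C) (j : C) (hj : j ∈ U)
      (hmin : ∀ i ∈ U, closeAvg I close j + closeMax I close j
        ≤ closeAvg I close i + closeMax I close i)
      (hcluster : ∀ i ∈ U, i = j ∨ Neighbor close j i → center i = j)
      (hrest : ClusterRun I close (U.filter fun i => ¬(i = j ∨ Neighbor close j i)) center) :
      ClusterRun I close U center

/-- The outcome of the deterministic steps of `A(γ)`. All choices that the algorithm leaves open
(the optimal LP solution, ties in sorting and in clustering) are arbitrary. -/
structure Run (I : Instance k C F X) (γ : ℝ) where
  sol : FracSol C F
  sol_optimal : sol.Optimal I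
  xbar : C → Path F → ℝ
  xbar_recomputed : Recomputed I sol γ xbar
  close : C → Path F → ℝ
  close_isClosePart : ∀ j ∈ bigClients sol γ, IsClosePart I j (xbar j) (close j)
  center : C → C
  center_clusterRun : ClusterRun I close (bigClients sol γ) center

namespace Run

variable {I : Instance k C F X} {γ : ℝ} (R : Run I γ)

/-- The cluster centers. -/
def centers : Finset C := (bigClients R.sol γ).image R.center

/-- The scaled opening `x_q` of a forest vertex, as a probability. -/
def vertexProb (q : Node F) : ℝ := min 1 (γ * R.sol.opening q)

/-- `x_{father(q)}`, with the value `1` if `q` is a root. -/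
def fatherProb (q : Node F) : ℝ :=
  if h : q.1.1 + 1 < k then R.vertexProb (q.father h) else 1

/-- `y_q`: the extent to which `q` is used by the close flow of a cluster center (close paths of
different centers lie in different trees, so at most one center contributes). -/
def centerUsage (q : Node F) : ℝ :=
  ∑ c ∈ R.centers, ∑ p with Path.Through p q, R.close c p

/-- The probability with which a vertex without a token is opened when its father is open. It is
the one for which `q` is open with probability `x_q`, since
`y_q + (x_{father(q)} - y_q) * coinProb q = x_q`. -/
def coinProb (q : Node F) : ℝ :=
  (R.vertexProb q - R.centerUsage q) / (R.fatherProb q - R.centerUsage q)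

/-- The outcomes of the random choices of the rounding: each cluster center `c` chooses one path,
down which its token travels, and each forest vertex tosses a coin. -/
abbrev Outcome : Type (max u v) := ({c // c ∈ R.centers} → Path F) × (Node F → Bool)

/-- The probability of an outcome: the choices are independent, center `c` chooses `p` with
probability `close c p` (equivalently, its token passes from a vertex `q` to a child `q'` with
probability `y_{q'} / y_q`), and the coin of `q` succeeds with probability `coinProb q`. -/
def prob (ω : R.Outcome) : ℝ :=
  (∏ c, R.close c.1 (ω.1 c)) * ∏ q, if ω.2 q then R.coinProb q else 1 - R.coinProb q

/-- The vertices opened by the rounding: those with a token and, going down from the roots, those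
whose coin succeeds and whose father (if any) is open. -/
inductive Opened (ω : R.Outcome) : Node F → Prop
  | token (q : Node F) (c : {c // c ∈ R.centers}) (h : Path.Through (ω.1 c) q) : Opened ω q
  | root (q : Node F) (hq : ¬ q.1.1 + 1 < k) (hcoin : ω.2 q = true) : Opened ω q
  | child (q : Node F) (hq : q.1.1 + 1 < k) (hf : Opened ω (q.father hq))
      (hcoin : ω.2 q = true) : Opened ω q

/-- A facility is open if one of its copies is. -/
def FacOpen (ω : R.Outcome) (t : Fin k) (i : F t) : Prop :=
  ∃ q : Node F, R.Opened ω q ∧ (⟨q.1, q.facility⟩ : (t : Fin k) × F t) = ⟨t, i⟩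

/-- The facility cost of the solution. -/
def facilityCost (ω : R.Outcome) : ℝ :=
  ∑ t : Fin k, ∑ i : F t, if R.FacOpen ω t i then I.openCost t i else 0

/-- The connection or penalty cost of client `j`, which is connected to a closest open path unless
rejecting it is cheaper. -/
def clientCost (ω : R.Outcome) (j : C) : ℝ :=
  (insert (I.penalty j)
    ((Finset.univ.filter fun p : Path F => ∀ t, R.FacOpen ω t (p t)).image
      (I.pathCost j))).min' (Finset.insert_nonempty _ _)

/-- Expectation over the random choices of the rounding. -/
def expect (f : R.Outcome → ℝ) : ℝ := ∑ ω, R.prob ω * f ω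

end Run

end LP

/-- The bound `f_k(z)`, `0 ≤ z ≤ 1`, for the probability that a single tree with flow `z` contains
an open path. (The value at `k = 0` is never used.) -/
def treeProb : ℕ → ℝ → ℝ
  | 0, _ => 0
  | 1, z => z
  | k + 2, z => z * sInf {r | ∃ (n : ℕ) (a : Fin n → ℝ), (∀ i, 0 < a i) ∧ ∑ i, a i = z ∧
      r = 1 - ∏ i, (1 - treeProb (k + 1) (a i / z))}

/-- The bound `F_k(x)` for the probability that there is an open path among paths of total flow
`x`; a single tree carries a flow of at most `1`. -/
def pathProb (k : ℕ) (x : ℝ) : ℝ :=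
  1 - sSup {r | ∃ (n : ℕ) (a : Fin n → ℝ), (∀ i, 0 < a i ∧ a i ≤ 1) ∧ ∑ i, a i = x ∧
      r = ∏ i, (1 - treeProb k (a i))}

end KLevelUFL

end

/-! The analysis of the algorithm `A(γ)`.

**The functions.** Splitting flow into many equal parts shows `f_k(z) ≤ rate k * z` and
`F_k(x) ≤ 1 - exp (-rate k * x)`, where `rate 1 = 1` and `rate (k + 1) = 1 - exp (-rate k)`
(`treeProb_bounds`, `pathProb_le`). The claimed ratio decreases in `F_k`, so it suffices to prove
the bound with these concave functions in place of `F_k`.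

**Open paths.** Given the tokens, the probability that no path of a given set is open is a product
over the forest, computed level by level (`prodExpect_miss`). Averaging over the tokens, which
pass to exactly one child, gives at most what independent openings with the same marginals would
give (`sum_mul_prod_erase_le`). Induction on the level then bounds the probability that no path of
a flow of size `m` is open by `exp (-rate k * m)` (`Rounding.level_bound`,
`Rounding.prodExpect_no_path_le`).

**A single client.** Let `o` be the cost of the cheapest open path among those that carry flow of
client `j`, capped by the penalty. Expectations of the form `E[min o b]` are integrals of tail
probabilities, which are at most `exp (-rate k * m(s))` for the flow `m(s)` of cost at most `s`.
If this is not enough, `j` uses the path with the token of its cluster center, whose cost is at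
most `δ + t`, where `δ` is the distance to the center and `t` the cost of the path for the center.
The absence of cheap open paths of `j` may be positively correlated with `t`, which is dealt with in
two ways. If `δ` is moderate, the maximal value of `t` is good enough. If `δ` is large, one uses
that a token path of cost `t` can only open paths of `j` of cost at least `δ - t`
(`Run.min_ownCost_le`). As `t` is independent of what is open without this token, the pathwise
inequality `token_detour_le` bounds the expected cost by
`E[min o δ] + E[min o δ - min o (δ - A)]` with `A = E[t]`. The two estimates together suffice for
`γ ≤ 3` (`clustered_bound`, through `integral_tailBound_far_le`). The resulting bound is linear in
the average costs of close and distant flow, and its extreme cases are the two terms of the maximum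
(`combine_bound`).

**Facilities.** Every vertex `q` is open with probability at most `x_q`
(`Run.expect_opened_le`). -/

noncomputable section

namespace KLevelUFL

open scoped Classical
open Filter Topology

universe u v w

/-! ### Expectations of finitely many independent choices -/

section ProductExpectation

variable {ι α : Type*} [Fintype ι] [Fintype α]

/-- The expectation of `f` when the coordinates are chosen independently and coordinate `i` equals
`a` with probability `w i a`. -/
def prodExpect (w : ι → α → ℝ) (f : (ι → α) → ℝ) : ℝ := ∑ ω, (∏ i, w i (ω i)) * f ω

theorem prodExpect_add (w : ι → α → ℝ) (f g : (ι → α) → ℝ) :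
    prodExpect w (fun ω => f ω + g ω) = prodExpect w f + prodExpect w g := by
  simp [prodExpect, mul_add, Finset.sum_add_distrib]

theorem prodExpect_const_mul (w : ι → α → ℝ) (r : ℝ) (f : (ι → α) → ℝ) :
    prodExpect w (fun ω => r * f ω) = r * prodExpect w f := by
  simp only [prodExpect, Finset.mul_sum]
  exact Finset.sum_congr rfl fun ω _ => by ring

theorem prodExpect_sub (w : ι → α → ℝ) (f g : (ι → α) → ℝ) :
    prodExpect w (fun ω => f ω - g ω) = prodExpect w f - prodExpect w g := by
  simp [prodExpect, mul_sub, Finset.sum_sub_distrib]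

theorem prodExpect_const {w : ι → α → ℝ} (hw : ∀ i, ∑ a, w i a = 1) (r : ℝ) :
    prodExpect w (fun _ => r) = r := by
  rw [prodExpect, ← Finset.sum_mul, ← Fintype.prod_sum]
  simp [hw]

theorem prodExpect_sum {κ : Type*} (s : Finset κ) (w : ι → α → ℝ) (f : κ → (ι → α) → ℝ) :
    prodExpect w (fun ω => ∑ x ∈ s, f x ω) = ∑ x ∈ s, prodExpect w (f x) := by
  simp only [prodExpect, Finset.mul_sum]
  exact Finset.sum_comm

/-- It suffices to compare the two functions on the outcomes of positive probability. -/
theorem prodExpect_mono {w : ι → α → ℝ} (hw : ∀ i a, 0 ≤ w i a) {f g : (ι → α) → ℝ}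
    (h : ∀ ω, (∀ i, 0 < w i (ω i)) → f ω ≤ g ω) : prodExpect w f ≤ prodExpect w g := by
  refine Finset.sum_le_sum fun ω _ => ?_
  by_cases hpos : ∀ i, 0 < w i (ω i)
  · exact mul_le_mul_of_nonneg_left (h ω hpos) (Finset.prod_nonneg fun i _ => hw _ _)
  · push Not at hpos
    obtain ⟨i, hi⟩ := hpos
    have h0 : ∏ i, w i (ω i) = 0 :=
      Finset.prod_eq_zero (Finset.mem_univ i) (le_antisymm hi (hw _ _))
    simp [h0]

/-- Coordinate `i` may be chosen a second time. -/
theorem prodExpect_update {w : ι → α → ℝ} (i : ι) (hw : ∑ a, w i a = 1) (f : (ι → α) → ℝ) :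
    prodExpect w f = prodExpect w (fun ω => ∑ a, w i a * f (Function.update ω i a)) := by
  have hsplit : ∀ ω : ι → α, ∏ j, w j (ω j) = w i (ω i) * ∏ j ∈ Finset.univ.erase i, w j (ω j) :=
    fun ω => (Finset.mul_prod_erase _ _ (Finset.mem_univ i)).symm
  have hupd : ∀ (ω : ι → α) (a : α), ∏ j ∈ Finset.univ.erase i, w j (Function.update ω i a j)
      = ∏ j ∈ Finset.univ.erase i, w j (ω j) := fun ω a =>
    Finset.prod_congr rfl fun j hj => by rw [Function.update_of_ne (Finset.ne_of_mem_erase hj)]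
  -- exchange the old and the new value of the coordinate
  let e : (ι → α) × α ≃ (ι → α) × α :=
    { toFun := fun x => (Function.update x.1 i x.2, x.1 i)
      invFun := fun x => (Function.update x.1 i x.2, x.1 i)
      left_inv := fun x => by simp
      right_inv := fun x => by simp }
  have h1 : prodExpect w f = ∑ x : (ι → α) × α, (∏ j, w j (x.1 j)) * w i x.2 * f x.1 := by
    rw [Fintype.sum_prod_type, prodExpect]
    refine Finset.sum_congr rfl fun ω _ => ?_
    simp only
    rw [← Finset.sum_mul, ← Finset.mul_sum, hw, mul_one]
  have h2 : prodExpect w (fun ω => ∑ a, w i a * f (Function.update ω i a))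
      = ∑ x : (ι → α) × α, (∏ j, w j (x.1 j)) * w i x.2 * f (Function.update x.1 i x.2) := by
    rw [Fintype.sum_prod_type, prodExpect]
    refine Finset.sum_congr rfl fun ω _ => ?_
    rw [Finset.mul_sum]
    exact Finset.sum_congr rfl fun a _ => by ring
  rw [h1, h2]
  refine Fintype.sum_equiv e _ _ fun x => ?_
  simp only [e, Equiv.coe_fn_mk, Function.update_idem, Function.update_eq_self]
  rw [hsplit, hsplit, hupd, Function.update_self]
  ring

/-- Integrating out the coordinates in `S` from a product whose factors depend on at most one of
them each. -/
theorem prodExpect_mul_prod {w : ι → α → ℝ} (hw : ∀ i, ∑ a, w i a = 1) (S : Finset ι)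
    (φ : ι → (ι → α) → α → ℝ) (H : (ι → α) → ℝ)
    (hφ : ∀ i ∈ S, ∀ j ∈ S, ∀ ω a, φ i (Function.update ω j a) = φ i ω)
    (hH : ∀ j ∈ S, ∀ ω a, H (Function.update ω j a) = H ω) :
    prodExpect w (fun ω => H ω * ∏ i ∈ S, φ i ω (ω i)) =
      prodExpect w (fun ω => H ω * ∏ i ∈ S, ∑ a, w i a * φ i ω a) := by
  induction S using Finset.induction_on generalizing H with
  | empty => simp
  | insert x S hx ih =>
    have h1 : (fun ω : ι → α => H ω * ∏ i ∈ insert x S, φ i ω (ω i))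
        = fun ω => (H ω * φ x ω (ω x)) * ∏ i ∈ S, φ i ω (ω i) := by
      funext ω
      rw [Finset.prod_insert hx, mul_assoc]
    rw [h1, ih (fun ω => H ω * φ x ω (ω x))
      (fun i hi j hj => hφ i (Finset.mem_insert_of_mem hi) j (Finset.mem_insert_of_mem hj))
      (fun j hj ω a => by
        have hne : x ≠ j := fun h => hx (h ▸ hj)
        rw [hH j (Finset.mem_insert_of_mem hj),
          hφ x (Finset.mem_insert_self _ _) j (Finset.mem_insert_of_mem hj),
          Function.update_of_ne hne])]
    rw [prodExpect_update x (hw x)]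
    congr 1
    funext ω
    rw [Finset.prod_insert hx]
    have hprod : ∀ a, ∏ i ∈ S, ∑ b, w i b * φ i (Function.update ω x a) b
        = ∏ i ∈ S, ∑ b, w i b * φ i ω b := fun a =>
      Finset.prod_congr rfl fun i hi => by
        rw [hφ i (Finset.mem_insert_of_mem hi) x (Finset.mem_insert_self _ _)]
    simp only [hprod, Function.update_self, hH x (Finset.mem_insert_self _ _),
      hφ x (Finset.mem_insert_self _ _) x (Finset.mem_insert_self _ _)]
    rw [← mul_assoc, Finset.mul_sum, Finset.sum_mul]
    exact Finset.sum_congr rfl fun a _ => by ring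

theorem prodExpect_prod (w f : ι → α → ℝ) :
    prodExpect w (fun ω => ∏ i, f i (ω i)) = ∏ i, ∑ a, w i a * f i a := by
  rw [Fintype.prod_sum, prodExpect]
  exact Finset.sum_congr rfl fun ω _ => Finset.prod_mul_distrib.symm

theorem prodExpect_apply {w : ι → α → ℝ}
    (hw : ∀ i, ∑ a, w i a = 1) (i : ι) (g : α → ℝ) :
    prodExpect w (fun ω => g (ω i)) = ∑ a, w i a * g a := by
  rw [prodExpect_update i (hw i)]
  simp only [Function.update_self]
  exact prodExpect_const hw _

end ProductExpectation

/-! ### The functions `f_k` and `F_k` -/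

/-- The slope of the linear function `f_k`: in fact `f_k(z) = rate k * z` and
`F_k(x) = 1 - exp (-rate k * x)`. The value at `k = 0` is never used. -/
def rate : ℕ → ℝ
  | 0 => 1
  | 1 => 1
  | k + 2 => 1 - Real.exp (-rate (k + 1))

theorem rate_mem (k : ℕ) : 0 ≤ rate k ∧ rate k ≤ 1 := by
  induction k using rate.induct with
  | case1 => simp [rate]
  | case2 => simp [rate]
  | case3 k ih =>
    rw [rate]
    have h1 : Real.exp (-rate (k + 1)) ≤ 1 := Real.exp_le_one_iff.2 (by linarith [ih.1])
    have h2 := Real.exp_pos (-rate (k + 1))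
    constructor <;> linarith

theorem rate_succ_le (k : ℕ) : rate (k + 2) ≤ rate (k + 1) := by
  rw [rate]
  linarith [Real.add_one_le_exp (-rate (k + 1))]

theorem prod_one_sub_mem {n : ℕ} {b : Fin n → ℝ} (hb : ∀ i, 0 ≤ b i ∧ b i ≤ 1) :
    0 ≤ ∏ i, (1 - b i) ∧ ∏ i, (1 - b i) ≤ 1 :=
  ⟨Finset.prod_nonneg fun i _ => by linarith [(hb i).2],
    Finset.prod_le_one (fun i _ => by linarith [(hb i).2]) fun i _ => by linarith [(hb i).1]⟩

theorem div_sum_mem {n : ℕ} {a : Fin n → ℝ} {z : ℝ} (ha : ∀ i, 0 < a i) (hs : ∑ i, a i = z)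
    (i : Fin n) : 0 ≤ a i / z ∧ a i / z ≤ 1 := by
  have hle : a i ≤ z := hs ▸ Finset.single_le_sum (fun j _ => (ha j).le) (Finset.mem_univ i)
  have hz : 0 < z := (ha i).trans_le hle
  exact ⟨(div_pos (ha i) hz).le, (div_le_one hz).2 hle⟩

/-- The products that arise from splitting a flow into `n` equal parts. -/
theorem tendsto_one_sub_div_pow (x : ℝ) :
    Tendsto (fun n : ℕ => (1 - x / n) ^ n) atTop (𝓝 (Real.exp (-x))) := by
  refine (Real.tendsto_one_add_div_pow_exp (-x)).congr fun n => ?_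
  rw [neg_div, ← sub_eq_add_neg]

/-- Only this half of `f_k(z) = rate k * z` is needed; the parts of equal size show it. -/
theorem treeProb_bounds (k : ℕ) : ∀ z : ℝ, 0 ≤ z → z ≤ 1 →
    0 ≤ treeProb (k + 1) z ∧ treeProb (k + 1) z ≤ rate (k + 1) * z := by
  induction k with
  | zero => intro z h0 _; simp [treeProb, rate, h0]
  | succ k ih =>
    intro z h0 h1
    have hmem : ∀ b : ℝ, 0 ≤ b → b ≤ 1 → 0 ≤ treeProb (k + 1) b ∧ treeProb (k + 1) b ≤ 1 :=
      fun b hb0 hb1 => ⟨(ih b hb0 hb1).1, (ih b hb0 hb1).2.trans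
        (mul_le_one₀ (rate_mem _).2 hb0 hb1)⟩
    set S : Set ℝ := {r | ∃ (n : ℕ) (a : Fin n → ℝ), (∀ i, 0 < a i) ∧ ∑ i, a i = z ∧
      r = 1 - ∏ i, (1 - treeProb (k + 1) (a i / z))} with hS
    have hdef : treeProb (k + 2) z = z * sInf S := rfl
    have hSnonneg : ∀ r ∈ S, 0 ≤ r := by
      rintro r ⟨n, a, ha, hs, rfl⟩
      have := (prod_one_sub_mem (b := fun i => treeProb (k + 1) (a i / z)) fun i =>
        hmem _ (div_sum_mem ha hs i).1 (div_sum_mem ha hs i).2).2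
      linarith
    refine ⟨hdef ▸ mul_nonneg h0 (Real.sInf_nonneg hSnonneg), ?_⟩
    rcases h0.eq_or_lt with rfl | hz
    · simp [hdef]
    rw [hdef, mul_comm]
    refine mul_le_mul_of_nonneg_right ?_ h0
    have hbound : ∀ᶠ n : ℕ in atTop, sInf S ≤ 1 - (1 - rate (k + 1) / n) ^ n := by
      filter_upwards [eventually_ge_atTop 1] with n hn
      have hn' : (1 : ℝ) ≤ n := by exact_mod_cast hn
      have hin : (1 : ℝ) / n ≤ 1 := by rw [div_le_one (by linarith)]; exact hn'
      have hin0 : (0 : ℝ) ≤ 1 / n := by positivity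
      have hmemS : 1 - (1 - treeProb (k + 1) (1 / n)) ^ n ∈ S := by
        refine ⟨n, fun _ => z / n, fun _ => by positivity, ?_, ?_⟩
        · simp; field_simp
        · have : z / n / z = 1 / n := by field_simp
          simp [this]
      refine (csInf_le ⟨0, hSnonneg⟩ hmemS).trans ?_
      have h2 := (ih _ hin0 hin).2
      have h3 : rate (k + 1) * (1 / n) ≤ 1 := mul_le_one₀ (rate_mem _).2 hin0 hin
      have h4 : (1 - rate (k + 1) / n) ^ n ≤ (1 - treeProb (k + 1) (1 / n)) ^ n := by
        refine pow_le_pow_left₀ ?_ ?_ n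
        · rw [mul_one_div] at h3; linarith
        · rw [mul_one_div] at h2; linarith
      linarith
    exact ge_of_tendsto ((tendsto_one_sub_div_pow (rate (k + 1))).const_sub 1) hbound

theorem pathProb_le (k : ℕ) {x : ℝ} (hx : 0 < x) :
    pathProb (k + 1) x ≤ 1 - Real.exp (-(rate (k + 1) * x)) := by
  unfold pathProb
  set S : Set ℝ := {r | ∃ (n : ℕ) (a : Fin n → ℝ), (∀ i, 0 < a i ∧ a i ≤ 1) ∧ ∑ i, a i = x ∧
      r = ∏ i, (1 - treeProb (k + 1) (a i))} with hS
  have hSle : ∀ r ∈ S, r ≤ 1 := by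
    rintro r ⟨n, a, ha, -, rfl⟩
    refine (prod_one_sub_mem fun i => ?_).2
    obtain ⟨h1, h2⟩ := treeProb_bounds k (a i) (ha i).1.le (ha i).2
    exact ⟨h1, h2.trans (mul_le_one₀ (rate_mem _).2 (ha i).1.le (ha i).2)⟩
  have hbound : ∀ᶠ n : ℕ in atTop, (1 - rate (k + 1) * x / n) ^ n ≤ sSup S := by
    filter_upwards [eventually_ge_atTop (max 1 ⌈x⌉₊)] with n hn
    have hn1 : (1 : ℝ) ≤ n := by exact_mod_cast (le_max_left _ _).trans hn
    have hnx : x ≤ n := (Nat.le_ceil x).trans (by exact_mod_cast (le_max_right _ _).trans hn)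
    have hn0 : (0 : ℝ) < n := by linarith
    have hle : x / n ≤ 1 := (div_le_one hn0).2 hnx
    have hpos : 0 < x / n := div_pos hx hn0
    have hmemS : (1 - treeProb (k + 1) (x / n)) ^ n ∈ S := by
      refine ⟨n, fun _ => x / n, fun _ => ⟨hpos, hle⟩, ?_, by simp⟩
      simp; field_simp
    refine le_trans ?_ (le_csSup ⟨1, hSle⟩ hmemS)
    have h2 := (treeProb_bounds k _ hpos.le hle).2
    have h3 : rate (k + 1) * (x / n) ≤ 1 := mul_le_one₀ (rate_mem _).2 hpos.le hle
    rw [← mul_div_assoc] at h2 h3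
    exact pow_le_pow_left₀ (by linarith) (by linarith) n
  have := le_of_tendsto (tendsto_one_sub_div_pow (rate (k + 1) * x)) hbound
  linarith

/-! ### Integrals of tail probabilities -/

section Tails

open MeasureTheory intervalIntegral

theorem antitone_step (x : ℝ) : Antitone fun s : ℝ => if s < x then (1 : ℝ) else 0 := by
  intro s t hst
  dsimp only
  split_ifs with h1 h2
  · exact le_rfl
  · exact absurd (hst.trans_lt h1) h2
  · exact zero_le_one
  · exact le_rfl

theorem integral_step {a b : ℝ} (hab : a ≤ b) (x : ℝ) :
    ∫ s in a..b, (if s < x then (1 : ℝ) else 0) = min x b - min x a := by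
  have hone : ∀ c d : ℝ, c ≤ d → d ≤ x →
      ∫ s in c..d, (if s < x then (1 : ℝ) else 0) = d - c := fun c d hcd hd => by
    rw [integral_congr_Ioo_of_le hcd (g := fun _ => (1 : ℝ))]
    · simp
    · exact fun s hs => if_pos (hs.2.trans_le hd)
  have hzero : ∀ c d : ℝ, c ≤ d → x ≤ c →
      ∫ s in c..d, (if s < x then (1 : ℝ) else 0) = 0 := fun c d hcd hc => by
    rw [integral_congr_Ioo_of_le hcd (g := fun _ => (0 : ℝ))]
    · simp
    · exact fun s hs => if_neg (by linarith [hs.1])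
  rcases le_total x a with hxa | hxa
  · rw [hzero a b hab hxa, min_eq_left hxa, min_eq_left (hxa.trans hab), sub_self]
  rcases le_total x b with hxb | hxb
  · rw [← integral_add_adjacent_intervals (b := x) (antitone_step x).intervalIntegrable
      (antitone_step x).intervalIntegrable, hone a x hxa le_rfl, hzero x b hxb le_rfl,
      min_eq_left hxb, min_eq_right hxa, add_zero]
  · rw [hone a b hab hxb, min_eq_right hxb, min_eq_right hxa]

/-- The part of an expectation between two levels is the integral of the tail probabilities. -/
theorem sum_min_sub_min {Ω : Type*} [Fintype Ω] (p X : Ω → ℝ) {a b : ℝ} (hab : a ≤ b) :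
    ∑ ω, p ω * (min (X ω) b - min (X ω) a)
      = ∫ s in a..b, ∑ ω, p ω * (if s < X ω then (1 : ℝ) else 0) := by
  rw [intervalIntegral.integral_finsetSum
    fun ω _ => ((antitone_step (X ω)).intervalIntegrable.const_mul (p ω))]
  exact Finset.sum_congr rfl fun ω _ => by
    rw [intervalIntegral.integral_const_mul, integral_step hab]

theorem antitone_sum_step {Ω : Type*} [Fintype Ω] {p : Ω → ℝ} (hp : ∀ ω, 0 ≤ p ω) (X : Ω → ℝ) :
    Antitone fun s : ℝ => ∑ ω, p ω * (if s < X ω then (1 : ℝ) else 0) := fun _ _ hst =>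
  Finset.sum_le_sum fun ω _ => mul_le_mul_of_nonneg_left (antitone_step (X ω) hst) (hp ω)

theorem sum_min_sub_min_le {Ω : Type*} [Fintype Ω] {p : Ω → ℝ} (hp : ∀ ω, 0 ≤ p ω) (X : Ω → ℝ)
    {e : ℝ → ℝ} (he : Antitone e) {a b : ℝ} (ha : 0 ≤ a) (hab : a ≤ b)
    (h : ∀ s, 0 ≤ s → ∑ ω, p ω * (if s < X ω then (1 : ℝ) else 0) ≤ e s) :
    ∑ ω, p ω * (min (X ω) b - min (X ω) a) ≤ ∫ s in a..b, e s := by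
  rw [sum_min_sub_min p X hab]
  exact integral_mono_on hab (antitone_sum_step hp X).intervalIntegrable he.intervalIntegrable
    fun s hs => h s (ha.trans hs.1)

end Tails

/-! ### The numerical inequalities -/

section Numerics

open MeasureTheory intervalIntegral

theorem exp_mul_le_chord {θ : ℝ} (h0 : 0 ≤ θ) (h1 : θ ≤ 1) (y : ℝ) :
    Real.exp (θ * y) ≤ 1 - θ + θ * Real.exp y := by
  have := convexOn_exp.2 (Set.mem_univ 0) (Set.mem_univ y) (sub_nonneg.2 h1) h0 (by ring)
  simpa using this

/-- The tail bound `exp (-c m)` for a flow `m = γ - d`, in terms of the deficit `d`. -/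
def tailBound (c γ : ℝ) (d : ℝ → ℝ) (s : ℝ) : ℝ := Real.exp (-(c * γ)) * Real.exp (c * d s)

theorem antitone_tailBound {c γ : ℝ} (hc : 0 ≤ c) {d : ℝ → ℝ} (hd : Antitone d) :
    Antitone (tailBound c γ d) := fun s t hst => by
  unfold tailBound
  have := hd hst
  gcongr

theorem tailBound_le_chord {c γ : ℝ} (hγ : 1 < γ) {d : ℝ → ℝ} {s : ℝ} (h0 : 0 ≤ d s)
    (h1 : d s ≤ γ - 1) :
    tailBound c γ d s ≤ Real.exp (-(c * γ))
      + (Real.exp (-c) - Real.exp (-(c * γ))) / (γ - 1) * d s := by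
  have hg : 0 < γ - 1 := by linarith
  have h := exp_mul_le_chord (div_nonneg h0 hg.le) ((div_le_one hg).2 h1) (c * (γ - 1))
  have e1 : d s / (γ - 1) * (c * (γ - 1)) = c * d s := by field_simp
  have e2 : Real.exp (-(c * γ)) * Real.exp (c * (γ - 1)) = Real.exp (-c) := by
    rw [← Real.exp_add]; ring_nf
  rw [e1] at h
  have h2 := mul_le_mul_of_nonneg_left h (Real.exp_pos (-(c * γ))).le
  calc tailBound c γ d s ≤ _ := h2
    _ = Real.exp (-(c * γ)) + (Real.exp (-(c * γ)) * Real.exp (c * (γ - 1))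
          - Real.exp (-(c * γ))) / (γ - 1) * d s := by field_simp; ring
    _ = _ := by rw [e2]

/-- The tail beyond the close paths contributes at most as much as if all distant flow had the
same cost. -/
theorem integral_tailBound_le {c γ : ℝ} (hc0 : 0 ≤ c) (hγ : 1 < γ) {d : ℝ → ℝ} (hd : Antitone d)
    (hd0 : ∀ s, 0 ≤ d s) {M b z : ℝ} (hdg : ∀ s, M ≤ s → d s ≤ γ - 1) (hMb : M ≤ b)
    (hz : ∫ s in M..b, d s ≤ (γ - 1) * z) :
    ∫ s in M..b, tailBound c γ d s ≤ (Real.exp (-c) - Real.exp (-(c * γ))) * z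
      + Real.exp (-(c * γ)) * (b - M) := by
  have hg : 0 < γ - 1 := by linarith
  have hle : Real.exp (-(c * γ)) ≤ Real.exp (-c) := Real.exp_le_exp.2 (by nlinarith)
  have h1 : ∫ s in M..b, tailBound c γ d s ≤ ∫ s in M..b, (Real.exp (-(c * γ))
      + (Real.exp (-c) - Real.exp (-(c * γ))) / (γ - 1) * d s) :=
    integral_mono_on hMb (antitone_tailBound hc0 hd).intervalIntegrable
      (intervalIntegrable_const.add (hd.intervalIntegrable.const_mul _))
      fun s hs => tailBound_le_chord hγ (hd0 s) (hdg s hs.1)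
  rw [integral_add intervalIntegrable_const (hd.intervalIntegrable.const_mul _),
    intervalIntegral.integral_const_mul, intervalIntegral.integral_const, smul_eq_mul] at h1
  have h2 := mul_le_mul_of_nonneg_left hz (div_nonneg (sub_nonneg.2 hle) hg.le)
  have h3 : (Real.exp (-c) - Real.exp (-(c * γ))) / (γ - 1) * ((γ - 1) * z)
      = (Real.exp (-c) - Real.exp (-(c * γ))) * z := by field_simp
  linarith

/-- The excess of the tail over its limit beyond a level that exceeds twice the mean. Here
`γ ≤ 3` enters, through `c * (γ - 1) ≤ 2` and `(1 - y) * exp y ≤ 1`. -/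
theorem integral_tailBound_far_le {c γ : ℝ} (hc0 : 0 ≤ c) (hc1 : c ≤ 1) (hγ3 : γ ≤ 3)
    {d : ℝ → ℝ} (hd : Antitone d) (hd0 : ∀ s, 0 ≤ d s) {M b z h : ℝ} (hγ : 1 < γ)
    (hh : 2 * z ≤ h) (hh0 : 0 ≤ h) (hMb : M + h ≤ b) (hz : ∫ s in M..b, d s ≤ (γ - 1) * z) :
    ∫ s in (M + h)..b, tailBound c γ d s ≤ 2 * Real.exp (-(c * γ)) * z
      + Real.exp (-(c * γ)) * (b - (M + h)) := by
  set η := Real.exp (-(c * γ)) with hη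
  have hη0 : 0 < η := Real.exp_pos _
  have hg : 0 < γ - 1 := by linarith
  set x := d (M + h) with hx
  have hx0 : 0 ≤ x := hd0 _
  have hsplit : ∫ s in M..b, d s = (∫ s in M..(M + h), d s) + ∫ s in (M + h)..b, d s :=
    (integral_add_adjacent_intervals hd.intervalIntegrable hd.intervalIntegrable).symm
  have hlow : h * x ≤ ∫ s in M..(M + h), d s := by
    have := integral_mono_on (f := fun _ => x) (g := d) (a := M) (b := M + h) (μ := volume)
      (by linarith) intervalIntegrable_const hd.intervalIntegrable fun s hs => hd hs.2
    simpa using this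
  have hfar0 : 0 ≤ ∫ s in (M + h)..b, d s := integral_nonneg hMb fun s _ => hd0 s
  have hz0 : 0 ≤ z := by
    have : 0 ≤ (γ - 1) * z := by nlinarith
    exact nonneg_of_mul_nonneg_right this hg
  -- the chord of `exp (c * ·)` over `[0, x]`, with slope `σ`
  have key : ∃ σ, 0 ≤ σ ∧ (∀ s, M + h ≤ s → Real.exp (c * d s) ≤ 1 + σ * d s) ∧
      σ * ((γ - 1) * z - h * x) ≤ 2 * z := by
    rcases hx0.eq_or_lt with hx0 | hx0
    · refine ⟨0, le_rfl, fun s hs => ?_, by linarith⟩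
      have : d s = 0 := le_antisymm ((hd hs).trans hx0.symm.le) (hd0 s)
      simp [this]
    · have hE : 1 ≤ Real.exp (c * x) := Real.one_le_exp (by positivity)
      refine ⟨(Real.exp (c * x) - 1) / x, div_nonneg (by linarith) hx0.le, fun s hs => ?_, ?_⟩
      · have h1 := exp_mul_le_chord (div_nonneg (hd0 s) hx0.le)
          ((div_le_one hx0).2 (hd hs)) (c * x)
        have e1 : d s / x * (c * x) = c * d s := by field_simp
        rw [e1] at h1
        calc _ ≤ _ := h1
          _ = _ := by ring
      · have hnum : (Real.exp (c * x) - 1) * (γ - 1 - 2 * x) ≤ 2 * x := by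
          rcases hc0.eq_or_lt with hc | hc
          · simp [← hc, hx0.le]
          rcases le_total (γ - 1 - 2 * x) 0 with hneg | hpos
          · nlinarith
          have h1 : 1 - c * x ≤ Real.exp (-(c * x)) := by
            linarith [Real.add_one_le_exp (-(c * x))]
          have h2 : (1 - c * x) * Real.exp (c * x) ≤ 1 := by
            have := mul_le_mul_of_nonneg_right h1 (Real.exp_pos (c * x)).le
            rwa [← Real.exp_add, neg_add_cancel, Real.exp_zero] at this
          have h3 : c * (γ - 1 - 2 * x) ≤ 2 * (1 - c * x) := by nlinarith
          have h4 : (Real.exp (c * x) - 1) * (c * (γ - 1 - 2 * x))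
              ≤ (Real.exp (c * x) - 1) * (2 * (1 - c * x)) :=
            mul_le_mul_of_nonneg_left h3 (by linarith)
          have h5 : c * ((Real.exp (c * x) - 1) * (γ - 1 - 2 * x)) ≤ c * (2 * x) := by nlinarith
          exact le_of_mul_le_mul_left h5 hc
        rw [div_mul_eq_mul_div, div_le_iff₀ hx0]
        have h6 : (γ - 1) * z - h * x ≤ (γ - 1 - 2 * x) * z := by nlinarith
        calc (Real.exp (c * x) - 1) * ((γ - 1) * z - h * x)
            ≤ (Real.exp (c * x) - 1) * ((γ - 1 - 2 * x) * z) :=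
              mul_le_mul_of_nonneg_left h6 (by linarith)
          _ = (Real.exp (c * x) - 1) * (γ - 1 - 2 * x) * z := by ring
          _ ≤ 2 * x * z := mul_le_mul_of_nonneg_right hnum hz0
          _ = 2 * z * x := by ring
  obtain ⟨σ, hσ0, hσ, hσz⟩ := key
  have h1 : ∫ s in (M + h)..b, tailBound c γ d s
      ≤ ∫ s in (M + h)..b, (η + η * σ * d s) :=
    integral_mono_on hMb (antitone_tailBound hc0 hd).intervalIntegrable
      (intervalIntegrable_const.add (hd.intervalIntegrable.const_mul _)) fun s hs => by
        have := mul_le_mul_of_nonneg_left (hσ s hs.1) hη0.le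
        unfold tailBound
        rw [← hη]
        linarith
  rw [integral_add intervalIntegrable_const (hd.intervalIntegrable.const_mul _),
    intervalIntegral.integral_const_mul, intervalIntegral.integral_const, smul_eq_mul] at h1
  have h2 : η * σ * ∫ s in (M + h)..b, d s ≤ η * (2 * z) := by
    rw [mul_assoc]
    refine mul_le_mul_of_nonneg_left (le_trans ?_ hσz) hη0.le
    exact mul_le_mul_of_nonneg_left (by linarith) hσ0
  linarith

/-- The target is linear in the average costs `A ≤ D` of close and distant flow, so that the
approximation ratio `ρ` is decided by the extreme cases `A = D` and `A = 0`. -/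
theorem combine_bound {γ ζ η ρ A D K : ℝ} (hγ : 1 < γ) (hA : 0 ≤ A) (hAD : A ≤ D)
    (hK : (γ - 1) * D + A ≤ γ * K) (h1 : 1 + 2 * η ≤ ρ) (h2 : γ * (η + ζ) ≤ ρ * (γ - 1))
    (hρ : 0 ≤ ρ) : ζ * D + (1 - ζ) * A + η * (A + D) ≤ ρ * K := by
  have h3 := mul_le_mul_of_nonneg_left hK hρ
  have h4 := mul_nonneg (sub_nonneg.2 h2) (sub_nonneg.2 hAD)
  have h5 := mul_nonneg (mul_nonneg hA (by linarith : (0 : ℝ) ≤ γ)) (sub_nonneg.2 h1)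
  have h6 : γ * (ζ * D + (1 - ζ) * A + η * (A + D)) ≤ γ * (ρ * K) := by nlinarith
  exact le_of_mul_le_mul_left h6 (by linarith)

/-- The cost bound for a client with close paths of average cost `A` and maximal cost `M`, whose
cluster center has averages and maxima `A'`, `M'` and distance `δ`. The two hypotheses on the
expected cost `E` come from two ways of using the center's chosen path; the first one is good enough
unless the center is much farther away than `M + A'`. -/
theorem clustered_bound {c γ : ℝ} (hc0 : 0 ≤ c) (hc1 : c ≤ 1) (hγ : 1 < γ) (hγ3 : γ ≤ 3)
    {d : ℝ → ℝ} (hd : Antitone d) (hd0 : ∀ s, 0 ≤ d s) {M A M' A' δ K E ρ : ℝ} (hA : 0 ≤ A)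
    (hAM : A ≤ M) (hdg : ∀ s, M ≤ s → d s ≤ γ - 1) (hA' : 0 ≤ A')
    (hclose : ∫ s in 0..M, tailBound c γ d s
      ≤ Real.exp (-c) * M + (1 - Real.exp (-c)) * A)
    (hdM : (γ - 1) * M + A ≤ ∫ s in 0..M, d s) (hdK : ∀ b, 0 ≤ b → ∫ s in 0..b, d s ≤ γ * K)
    (hδ : δ ≤ M + M') (hcenter : A' + M' ≤ A + M)
    (hE1 : ∀ b, 0 ≤ b → δ + M' ≤ b → E ≤ ∫ s in 0..b, tailBound c γ d s)
    (hE2 : A' ≤ δ → E ≤ (∫ s in 0..δ, tailBound c γ d s) + ∫ s in (δ - A')..δ, tailBound c γ d s)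
    (h1 : 1 + 2 * Real.exp (-(c * γ)) ≤ ρ)
    (h2 : γ * (Real.exp (-(c * γ)) + Real.exp (-c)) ≤ ρ * (γ - 1)) : E ≤ ρ * K := by
  set η := Real.exp (-(c * γ)) with hη
  set ζ := Real.exp (-c) with hζ
  have hη0 : 0 < η := Real.exp_pos _
  have hM : 0 ≤ M := hA.trans hAM
  have hg : 0 < γ - 1 := by linarith
  have hT := antitone_tailBound (γ := γ) hc0 hd
  -- `M + z` is the average cost of the distant flow
  obtain ⟨z, hz⟩ : ∃ z, (γ - 1) * z = γ * K - (γ - 1) * M - A :=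
    ⟨(γ * K - (γ - 1) * M - A) / (γ - 1), by field_simp⟩
  have hdz : ∀ b, M ≤ b → ∫ s in M..b, d s ≤ (γ - 1) * z := fun b hb => by
    have := integral_add_adjacent_intervals (hd.intervalIntegrable (μ := volume) (a := 0) (b := M))
      (hd.intervalIntegrable (a := M) (b := b))
    linarith [hdK b (hM.trans hb)]
  have hz0 : 0 ≤ z := by
    have := hdz M le_rfl
    rw [integral_same] at this
    exact nonneg_of_mul_nonneg_right this hg
  have hfar : ∀ b, M ≤ b → ∫ s in 0..b, tailBound c γ d s
      ≤ ζ * M + (1 - ζ) * A + ((ζ - η) * z + η * (b - M)) := fun b hb => by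
    have h3 := integral_add_adjacent_intervals
      (hT.intervalIntegrable (μ := volume) (a := 0) (b := M))
      (hT.intervalIntegrable (a := M) (b := b))
    have h4 := integral_tailBound_le hc0 hγ hd hd0 hdg hb (hdz b hb)
    linarith
  have htarget : ζ * (M + z) + (1 - ζ) * A + η * (A + (M + z)) ≤ ρ * K :=
    combine_bound hγ hA (by linarith) (by linarith) h1 h2 (by linarith)
  refine le_trans ?_ htarget
  rcases le_total (δ - M - A') (2 * z) with hh | hh
  · have h3 := hE1 (max M (δ + M')) (hM.trans (le_max_left _ _)) (le_max_right _ _)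
    have h4 := hfar _ (le_max_left M (δ + M'))
    have h5 : max M (δ + M') - M ≤ A + M + 2 * z := by
      rw [sub_le_iff_le_add]
      exact max_le (by linarith) (by linarith)
    have h6 := mul_le_mul_of_nonneg_left h5 hη0.le
    linarith
  · have h3 := hE2 (by linarith)
    have h4 := hfar δ (by linarith)
    have h5 := integral_tailBound_far_le hc0 hc1 hγ3 hd hd0 hγ hh (by linarith)
      (b := δ) (M := M) (by linarith) (hdz δ (by linarith))
    have e1 : M + (δ - M - A') = δ - A' := by ring
    rw [e1, ← hη] at h5
    have h6 : η * (δ - M + A') ≤ η * (A + M) := mul_le_mul_of_nonneg_left (by linarith) hη0.le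
    linarith

/-- The cost bound for a client that only pays for its own open paths or for being rejected, at a
cost of `P`. The function `a` is the missing part of the first unit of flow. -/
theorem rejectable_bound {c γ : ℝ} (hc0 : 0 ≤ c) (hγ : 1 < γ) {d a : ℝ → ℝ}
    (hd : Antitone d) (ha : Antitone a) (ha0 : ∀ s, 0 ≤ a s) (ha1 : ∀ s, 0 ≤ s → a s ≤ 1)
    {P K E ρ : ℝ} (hP : 0 ≤ P)
    (hclose : ∀ s, 0 ≤ s → s < P →
      tailBound c γ d s ≤ Real.exp (-c) + (1 - Real.exp (-c)) * a s)
    (haK : (γ - 1) * P + ∫ s in 0..P, a s ≤ γ * K)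
    (hE : E ≤ ∫ s in 0..P, tailBound c γ d s)
    (h1 : 1 + 2 * Real.exp (-(c * γ)) ≤ ρ)
    (h2 : γ * (Real.exp (-(c * γ)) + Real.exp (-c)) ≤ ρ * (γ - 1)) : E ≤ ρ * K := by
  set η := Real.exp (-(c * γ)) with hη
  set ζ := Real.exp (-c) with hζ
  have hη0 : 0 < η := Real.exp_pos _
  set A := ∫ s in 0..P, a s with hA
  have hA0 : 0 ≤ A := integral_nonneg hP fun s _ => ha0 s
  have hAP : A ≤ P := by
    have := integral_mono_on (f := a) (g := fun _ => 1) (a := 0) (b := P) (μ := volume) hP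
      ha.intervalIntegrable intervalIntegrable_const fun s hs => ha1 s hs.1
    simpa using this
  have h3 : ∫ s in 0..P, tailBound c γ d s ≤ ∫ s in 0..P, (ζ + (1 - ζ) * a s) :=
    integral_mono_on_of_le_Ioo hP (antitone_tailBound hc0 hd).intervalIntegrable
      (intervalIntegrable_const.add (ha.intervalIntegrable.const_mul _))
      fun s hs => hclose s hs.1.le hs.2
  rw [integral_add intervalIntegrable_const (ha.intervalIntegrable.const_mul _),
    intervalIntegral.integral_const_mul, intervalIntegral.integral_const, smul_eq_mul] at h3
  have h4 : ζ * P + (1 - ζ) * A + η * (A + P) ≤ ρ * K :=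
    combine_bound hγ hA0 hAP haK h1 h2 (by linarith)
  have h5 : 0 ≤ η * (A + P) := by positivity
  linarith

end Numerics

/-! ### The forest of end pieces of paths -/

section ForestFacts

variable {k : ℕ} {F : Fin k → Type v}

theorem Path.through_node (p : Path F) (t : Fin k) : Path.Through p (Path.node p t) := rfl

theorem Path.Through.father {p : Path F} {q : Node F} (hp : Path.Through p q)
    (h : q.1.1 + 1 < k) : Path.Through p (q.father h) := by
  obtain ⟨t, f⟩ := q
  obtain rfl : f = fun s : {s : Fin k // t ≤ s} => p s.1 := (eq_of_heq (Sigma.mk.inj hp).2).symm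
  rfl

theorem Path.node_eq_of_level {p : Path F} {q : Node F} (hp : Path.Through p q) {t : Fin k}
    (ht : q.1 = t) : Path.node p t = q := ht ▸ hp

/-- The top level. -/
def topLevel (k : ℕ) [NeZero k] : Fin k := ⟨k - 1, Nat.sub_lt (NeZero.pos k) one_pos⟩

/-- The top-level facility `i_k` of `(i_t, …, i_k)`, which identifies its tree. -/
def Node.top [NeZero k] (q : Node F) : F (topLevel k) :=
  q.2 ⟨topLevel k, Fin.le_def.2 (Nat.le_sub_one_of_lt q.1.2)⟩

theorem Path.Through.top_eq [NeZero k] {p : Path F} {q : Node F} (hp : Path.Through p q) :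
    q.top = p (topLevel k) := by
  obtain ⟨t, f⟩ := q
  obtain rfl : f = fun s : {s : Fin k // t ≤ s} => p s.1 := (eq_of_heq (Sigma.mk.inj hp).2).symm
  rfl

/-- A root is determined by its facility. -/
theorem Path.through_of_top_eq [NeZero k] {p : Path F} {q : Node F} (hq : q.1.1 = k - 1)
    (h : q.top = p (topLevel k)) : Path.Through p q := by
  obtain ⟨t, f⟩ := q
  have ht : t = topLevel k := Fin.ext hq
  subst ht
  refine Sigma.ext rfl (heq_of_eq (funext fun s => ?_))
  have hs : s = ⟨topLevel k, le_rfl⟩ :=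
    Subtype.ext (le_antisymm (Fin.le_def.2 (Nat.le_sub_one_of_lt s.1.2)) s.2)
  rw [hs]
  exact h.symm

variable [∀ t, Fintype (F t)]

/-- The vertices whose father is `q`. -/
def children (q : Node F) : Finset (Node F) :=
  Finset.univ.filter fun q' => ∃ h : q'.1.1 + 1 < k, q'.father h = q

theorem mem_children {q q' : Node F} :
    q' ∈ children q ↔ ∃ h : q'.1.1 + 1 < k, q'.father h = q := by
  simp [children]

theorem level_of_mem_children {q q' : Node F} (h : q' ∈ children q) : q'.1.1 + 1 = q.1.1 := by
  obtain ⟨h', rfl⟩ := mem_children.1 h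
  rfl

/-- The vertices of level `n`, counted from `0`. -/
def levelNodes (F : Fin k → Type v) [∀ t, Fintype (F t)] (n : ℕ) : Finset (Node F) :=
  Finset.univ.filter fun q => q.1.1 = n

theorem mem_levelNodes {n : ℕ} {q : Node F} : q ∈ levelNodes F n ↔ q.1.1 = n := by
  simp [levelNodes]

/-- A path through a vertex above the lowest level passes through exactly one of its children. -/
theorem sum_through_children (q : Node F) {n : ℕ} (hn : q.1.1 = n + 1) (f : Path F → ℝ) :
    ∑ p with Path.Through p q, f p
      = ∑ q' ∈ children q, ∑ p with Path.Through p q', f p := by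
  have hlt : n < k := by have := q.1.2; omega
  have hmaps : ∀ p ∈ (Finset.univ.filter fun p : Path F => Path.Through p q),
      Path.node p ⟨n, hlt⟩ ∈ children q := fun p hp => by
    have hp := (Finset.mem_filter.1 hp).2
    refine mem_children.2 ⟨show n + 1 < k by rw [← hn]; exact q.1.2, ?_⟩
    exact Path.node_eq_of_level hp (Fin.ext hn)
  rw [← Finset.sum_fiberwise_of_maps_to hmaps]
  refine Finset.sum_congr rfl fun q' hq' => Finset.sum_congr ?_ fun _ _ => rfl
  have hl := level_of_mem_children hq'
  have hq'n : q'.1 = ⟨n, hlt⟩ := Fin.ext (by simp only; omega)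
  ext p
  simp only [Finset.mem_filter, Finset.mem_univ, true_and]
  constructor
  · rintro ⟨-, h⟩
    rw [← hq'n] at h
    exact h
  · intro h
    obtain ⟨h', rfl⟩ := mem_children.1 hq'
    exact ⟨h.father h', Path.node_eq_of_level h hq'n⟩

/-- The vertices of one level are grouped by their fathers. -/
theorem prod_levelNodes_succ (n : ℕ) (hn : n + 1 < k) (f : Node F → ℝ) :
    ∏ q ∈ levelNodes F n, f q = ∏ q ∈ levelNodes F (n + 1), ∏ q' ∈ children q, f q' := by
  have hmaps : ∀ q' ∈ levelNodes F n,
      (if h : q'.1.1 + 1 < k then q'.father h else q') ∈ levelNodes F (n + 1) := fun q' hq' => by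
    have hq' := mem_levelNodes.1 hq'
    rw [dif_pos (by omega), mem_levelNodes]
    exact congrArg (· + 1) hq'
  rw [← Finset.prod_fiberwise_of_maps_to hmaps]
  refine Finset.prod_congr rfl fun q hq => Finset.prod_congr ?_ fun _ _ => rfl
  ext q'
  rw [Finset.mem_filter, mem_children, mem_levelNodes]
  have hq := mem_levelNodes.1 hq
  constructor
  · rintro ⟨h1, h2⟩
    have h : q'.1.1 + 1 < k := by omega
    rw [dif_pos h] at h2
    exact ⟨h, h2⟩
  · rintro ⟨h, rfl⟩
    exact ⟨Nat.succ_injective hq, dif_pos h⟩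

end ForestFacts

/-! ### Opening vertices by tokens and coins -/

section Opening

variable {k : ℕ} {F : Fin k → Type v}

/-- The open vertices when the vertices in `τ` have tokens and `b` lists the results of the coins:
those with a token, and those whose coin succeeds and whose father (if any) is open. -/
inductive OpenBy (τ : Node F → Prop) (b : Node F → Bool) : Node F → Prop
  | token (q : Node F) (h : τ q) : OpenBy τ b q
  | coin (q : Node F) (hc : b q = true)
      (hf : ∀ h : q.1.1 + 1 < k, OpenBy τ b (q.father h)) : OpenBy τ b q

theorem openBy_iff {τ : Node F → Prop} {b : Node F → Bool} {q : Node F} :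
    OpenBy τ b q ↔ τ q ∨ (b q = true ∧ ∀ h : q.1.1 + 1 < k, OpenBy τ b (q.father h)) := by
  constructor
  · intro h
    cases h with
    | token _ h => exact Or.inl h
    | coin _ hc hf => exact Or.inr ⟨hc, hf⟩
  · rintro (h | ⟨hc, hf⟩)
    · exact .token q h
    · exact .coin q hc hf

theorem OpenBy.mono {τ τ' : Node F → Prop} (hτ : ∀ q, τ q → τ' q) {b : Node F → Bool} {q : Node F}
    (h : OpenBy τ b q) : OpenBy τ' b q := by
  induction h with
  | token q h => exact .token q (hτ q h)
  | coin q hc _ ih => exact .coin q hc ih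

/-- Only the tokens in the tree of a vertex matter for it. -/
theorem OpenBy.of_token_iff [NeZero k] {τ τ' : Node F → Prop} {b : Node F → Bool} {q : Node F}
    (h : OpenBy τ b q) (hτ : ∀ q', q'.top = q.top → τ q' → τ' q') : OpenBy τ' b q := by
  induction h with
  | token q h => exact .token q (hτ q rfl h)
  | coin q hc _ ih => exact .coin q hc fun h => ih h fun q' hq' => hτ q' hq'

/-- Only the coins on the level of a vertex and above it matter for it. -/
theorem OpenBy.congr_coins {τ : Node F → Prop} {b b' : Node F → Bool} {q : Node F}
    (h : OpenBy τ b q) (hb : ∀ q' : Node F, q.1.1 ≤ q'.1.1 → b q' = b' q') : OpenBy τ b' q := by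
  induction h with
  | token q h => exact .token q h
  | coin q hc _ ih =>
    refine .coin q (hb q le_rfl ▸ hc) fun h => ih h fun q' hq' => hb q' ?_
    exact (Nat.le_succ _).trans hq'

theorem openBy_iff_of_eq_off {τ : Node F → Prop} {b b' : Node F → Bool} {q j : Node F}
    (hb : ∀ q', q' ≠ j → b' q' = b q') (hj : j.1.1 < q.1.1) : OpenBy τ b' q ↔ OpenBy τ b q := by
  have hne : ∀ q' : Node F, q.1.1 ≤ q'.1.1 → b' q' = b q' := fun q' hq' =>
    hb q' fun h => by subst h; omega
  exact ⟨fun h => h.congr_coins hne, fun h => h.congr_coins fun q' hq' => (hne q' hq').symm⟩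

theorem OpenBy.father {τ : Node F → Prop}
    (hτ : ∀ (q : Node F) (h : q.1.1 + 1 < k), τ q → τ (q.father h)) {b : Node F → Bool}
    {q : Node F} (hq : OpenBy τ b q) (h : q.1.1 + 1 < k) : OpenBy τ b (q.father h) := by
  cases hq with
  | token _ ht => exact .token _ (hτ q h ht)
  | coin _ _ hf => exact hf h

theorem OpenBy.path {τ : Node F → Prop} [NeZero k]
    (hτ : ∀ (q : Node F) (h : q.1.1 + 1 < k), τ q → τ (q.father h)) {b : Node F → Bool}
    {p : Path F} (hp : OpenBy τ b (Path.node p 0)) : ∀ t, OpenBy τ b (Path.node p t) := by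
  have key : ∀ n (hn : n < k), OpenBy τ b (Path.node p ⟨n, hn⟩) := by
    intro n
    induction n with
    | zero => exact fun _ => hp
    | succ n ih => exact fun hn => (ih (by omega)).father hτ hn
  exact fun t => key t.1 t.2

/-- The probability weights of the coins. -/
def coinWeight (π : Node F → ℝ) (q : Node F) (b : Bool) : ℝ := if b then π q else 1 - π q

theorem sum_coinWeight (π : Node F → ℝ) (q : Node F) : ∑ b, coinWeight π q b = 1 := by
  simp [coinWeight]

variable [∀ t, Fintype (F t)]

/-- For a vertex `q` of level `n`: the probability that no vertex of `Q` on the lowest level below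
`q` is open, given that `q` is open. -/
def missGiven (τ : Node F → Prop) (π : Node F → ℝ) (Q : Node F → Prop) : ℕ → Node F → ℝ
  | 0, q => if Q q then 0 else 1
  | n + 1, q => ∏ q' ∈ children q,
      if τ q' then missGiven τ π Q n q' else 1 - π q' * (1 - missGiven τ π Q n q')

/-- The same probability given that the father of `q` (if any) is open. -/
def miss (τ : Node F → Prop) (π : Node F → ℝ) (Q : Node F → Prop) (n : ℕ) (q : Node F) : ℝ :=
  if τ q then missGiven τ π Q n q else 1 - π q * (1 - missGiven τ π Q n q)

theorem missGiven_succ (τ : Node F → Prop) (π : Node F → ℝ) (Q : Node F → Prop) (n : ℕ)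
    (q : Node F) : missGiven τ π Q (n + 1) q = ∏ q' ∈ children q, miss τ π Q n q' := rfl

/-- Integrating out the coins of level `n`. -/
theorem prodExpect_level (τ : Node F → Prop) (π : Node F → ℝ) (Q : Node F → Prop)
    (hτ : ∀ (q : Node F) (h : q.1.1 + 1 < k), τ q → τ (q.father h)) (n : ℕ) :
    prodExpect (coinWeight π)
        (fun b => ∏ q ∈ levelNodes F n, if OpenBy τ b q then missGiven τ π Q n q else 1) =
      prodExpect (coinWeight π)
        (fun b => ∏ q ∈ levelNodes F n,
          if ∀ h : q.1.1 + 1 < k, OpenBy τ b (q.father h) then miss τ π Q n q else 1) := by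
  have h := prodExpect_mul_prod (w := coinWeight π) (sum_coinWeight π) (levelNodes F n)
    (fun q b a => if τ q ∨ (a = true ∧ ∀ h : q.1.1 + 1 < k, OpenBy τ b (q.father h))
      then missGiven τ π Q n q else 1) (fun _ => 1)
    (fun i hi j hj b a => by
      funext x
      exact if_congr (or_congr Iff.rfl (and_congr Iff.rfl (forall_congr' fun h =>
        openBy_iff_of_eq_off (fun _ hq' => dif_neg hq') (by
          rw [mem_levelNodes.1 hj]
          exact (mem_levelNodes.1 hi).symm ▸ Nat.lt_succ_self _)))) rfl rfl)
    (fun _ _ _ _ => rfl)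
  simp only [one_mul] at h
  convert h using 3 with b b
  · exact Finset.prod_congr rfl fun q _ => if_congr openBy_iff rfl rfl
  · refine Finset.prod_congr rfl fun q _ => ?_
    by_cases ht : τ q
    · have hf : ∀ h : q.1.1 + 1 < k, OpenBy τ b (q.father h) := fun h => .token _ (hτ q h ht)
      simp [ht, hf, miss, coinWeight]
      ring
    · by_cases hf : ∀ h : q.1.1 + 1 < k, OpenBy τ b (q.father h)
      · rw [if_pos hf]
        simp [ht, hf, miss, coinWeight]
        ring
      · rw [if_neg hf]
        simp [ht, hf, coinWeight]

/-- The probability that no lowest-level vertex in `Q` is open is a product over the trees. -/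
theorem prodExpect_miss [NeZero k] (τ : Node F → Prop) (π : Node F → ℝ) (Q : Node F → Prop)
    (hτ : ∀ (q : Node F) (h : q.1.1 + 1 < k), τ q → τ (q.father h)) :
    prodExpect (coinWeight π)
        (fun b => if ∃ q ∈ levelNodes F 0, Q q ∧ OpenBy τ b q then 0 else 1) =
      ∏ q ∈ levelNodes F (k - 1), miss τ π Q (k - 1) q := by
  have hlevels : ∀ n, n < k → prodExpect (coinWeight π)
      (fun b => if ∃ q ∈ levelNodes F 0, Q q ∧ OpenBy τ b q then 0 else 1) =
      prodExpect (coinWeight π)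
        (fun b => ∏ q ∈ levelNodes F n, if OpenBy τ b q then missGiven τ π Q n q else 1) := by
    intro n
    induction n with
    | zero =>
      intro _
      congr 1
      funext b
      split_ifs with h
      · obtain ⟨q, hq, hQ, ho⟩ := h
        exact (Finset.prod_eq_zero hq (by rw [if_pos ho]; simp [missGiven, hQ])).symm
      · push Not at h
        refine (Finset.prod_eq_one fun q hq => ?_).symm
        by_cases hQ : Q q
        · rw [if_neg (h q hq hQ)]
        · simp [missGiven, hQ]
    | succ n ih =>
      intro hn
      rw [ih (by omega), prodExpect_level τ π Q hτ]
      congr 1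
      funext b
      rw [prod_levelNodes_succ n hn]
      refine Finset.prod_congr rfl fun q hq => ?_
      rw [missGiven_succ]
      split_ifs with ho
      · refine Finset.prod_congr rfl fun q' hq' => if_pos fun h => ?_
        obtain ⟨h', rfl⟩ := mem_children.1 hq'
        exact ho
      · refine Finset.prod_eq_one fun q' hq' => if_neg fun hall => ?_
        obtain ⟨h', rfl⟩ := mem_children.1 hq'
        exact ho (hall h')
  have hk := NeZero.pos k
  rw [hlevels (k - 1) (by omega), prodExpect_level τ π Q hτ]
  have hroot : ∀ b : Node F → Bool, (∏ q ∈ levelNodes F (k - 1),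
      if ∀ h : q.1.1 + 1 < k, OpenBy τ b (q.father h) then miss τ π Q (k - 1) q else 1) =
      ∏ q ∈ levelNodes F (k - 1), miss τ π Q (k - 1) q := fun b =>
    Finset.prod_congr rfl fun q hq => if_pos fun h => by
      have := mem_levelNodes.1 hq
      omega
  simp only [hroot]
  exact prodExpect_const (sum_coinWeight π) _

theorem miss_mem {τ : Node F → Prop} {π : Node F → ℝ} {Q : Node F → Prop} {n : ℕ} {q : Node F}
    (hπ : 0 ≤ π q ∧ π q ≤ 1) (h : 0 ≤ missGiven τ π Q n q ∧ missGiven τ π Q n q ≤ 1) :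
    missGiven τ π Q n q ≤ miss τ π Q n q ∧ miss τ π Q n q ≤ 1 := by
  unfold miss
  split_ifs
  · exact ⟨le_rfl, h.2⟩
  · constructor <;> nlinarith [hπ.1, hπ.2, h.1, h.2]

theorem missGiven_mem {τ : Node F → Prop} {π : Node F → ℝ} (hπ : ∀ q, 0 ≤ π q ∧ π q ≤ 1)
    (Q : Node F → Prop) (n : ℕ) (q : Node F) :
    0 ≤ missGiven τ π Q n q ∧ missGiven τ π Q n q ≤ 1 := by
  induction n generalizing q with
  | zero => unfold missGiven; split_ifs <;> simp
  | succ n ih =>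
    rw [missGiven_succ]
    exact ⟨Finset.prod_nonneg fun q' _ => (ih q').1.trans (miss_mem (hπ q') (ih q')).1,
      Finset.prod_le_one (fun q' _ => (ih q').1.trans (miss_mem (hπ q') (ih q')).1)
        fun q' _ => (miss_mem (hπ q') (ih q')).2⟩

/-- Tokens only help. -/
theorem missGiven_le_of_imp {τ τ' : Node F → Prop} (hτ : ∀ q, τ q → τ' q) {π : Node F → ℝ}
    (hπ : ∀ q, 0 ≤ π q ∧ π q ≤ 1) (Q : Node F → Prop) (n : ℕ) (q : Node F) :
    missGiven τ' π Q n q ≤ missGiven τ π Q n q := by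
  induction n generalizing q with
  | zero => exact le_rfl
  | succ n ih =>
    rw [missGiven_succ, missGiven_succ]
    refine Finset.prod_le_prod (fun q' _ => (missGiven_mem hπ Q n q').1.trans
      (miss_mem (hπ q') (missGiven_mem hπ Q n q')).1) fun q' _ => ?_
    by_cases h : τ q'
    · simp only [miss, h, hτ q' h, if_true]
      exact ih q'
    by_cases h' : τ' q'
    · refine le_trans ?_ (miss_mem (hπ q') (missGiven_mem hπ Q n q')).1
      simpa only [miss, h', if_true] using ih q'
    · simp only [miss, h, h', if_false]
      have := mul_le_mul_of_nonneg_left (ih q') (hπ q').1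
      linarith

/-- Only the tokens in a part of the forest that is closed under taking children matter. -/
theorem missGiven_congr {τ τ' : Node F → Prop} {S : Node F → Prop}
    (hS : ∀ q, S q → ∀ q' ∈ children q, S q') (hτ : ∀ q, S q → (τ q ↔ τ' q)) (π : Node F → ℝ)
    (Q : Node F → Prop) (n : ℕ) (q : Node F) (hq : S q) :
    missGiven τ π Q n q = missGiven τ' π Q n q := by
  induction n generalizing q with
  | zero => rfl
  | succ n ih =>
    rw [missGiven_succ, missGiven_succ]
    refine Finset.prod_congr rfl fun q' hq' => ?_
    have hq'S := hS q hq q' hq'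
    simp only [miss, hτ q' hq'S, ih q' hq'S]

/-- The step from a father to its child in bounding the probability of being open. Here `O`, `o` are
the actual probabilities that the father and the child are open, `t` is that of a token at the
child, and `X`, `x`, `y` are the bounds for them. It uses `o = t + π (O - t)`, which is monotone in
both `O` and `t`. -/
theorem prob_open_step {x X y π o O t : ℝ} (hπ0 : 0 ≤ π) (hπ1 : π ≤ 1)
    (hcoin : π * (X - y) = x - y) (hO : O ≤ X) (ht : t ≤ y) (ho : o = t + π * (O - t)) : o ≤ x := by
  nlinarith [mul_nonneg hπ0 (sub_nonneg.2 hO), mul_nonneg (sub_nonneg.2 hπ1) (sub_nonneg.2 ht)]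

end Opening

/-! ### Tokens do not hurt -/

/-- A token passes to exactly one of several vertices. Compared with independent openings of the
same probabilities this negative correlation makes it less likely that nothing useful is open. -/
theorem sum_mul_prod_erase_le {ι : Type*} [DecidableEq ι] (s : Finset ι) (U θ m : ι → ℝ)
    (hθ : ∀ i ∈ s, θ i ≤ 1) (hm : ∀ i ∈ s, 0 ≤ m i) (hU0 : ∀ i ∈ s, 0 ≤ U i)
    (hU : ∀ i ∈ s, U i ≤ θ i * m i) :
    ∑ i ∈ s, U i * ∏ j ∈ s.erase i, m j + (1 - ∑ i ∈ s, θ i) * ∏ i ∈ s, m i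
      ≤ ∏ i ∈ s, (U i + (1 - θ i) * m i) := by
  induction s using Finset.induction_on with
  | empty => simp
  | insert a s ha ih =>
    have ih := ih (fun i hi => hθ i (Finset.mem_insert_of_mem hi))
      (fun i hi => hm i (Finset.mem_insert_of_mem hi))
      (fun i hi => hU0 i (Finset.mem_insert_of_mem hi))
      (fun i hi => hU i (Finset.mem_insert_of_mem hi))
    have hma := hm a (Finset.mem_insert_self _ _)
    have hUa := hU a (Finset.mem_insert_self _ _)
    have hsum : ∑ i ∈ s, U i * ∏ j ∈ (insert a s).erase i, m j
        = m a * ∑ i ∈ s, U i * ∏ j ∈ s.erase i, m j := by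
      rw [Finset.mul_sum]
      refine Finset.sum_congr rfl fun i hi => ?_
      have hne : a ≠ i := fun h => ha (h ▸ hi)
      rw [Finset.erase_insert_of_ne hne,
        Finset.prod_insert fun h => ha (Finset.mem_of_mem_erase h)]
      ring
    have hprod : ∏ i ∈ s, (U i + (1 - θ i) * m i) ≤ ∏ i ∈ s, m i :=
      Finset.prod_le_prod (fun i hi => by
        have h1 := hU0 i (Finset.mem_insert_of_mem hi)
        have h2 := mul_nonneg (sub_nonneg.2 (hθ i (Finset.mem_insert_of_mem hi)))
          (hm i (Finset.mem_insert_of_mem hi))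
        linarith) fun i hi => by
        have := hU i (Finset.mem_insert_of_mem hi)
        linarith
    rw [Finset.sum_insert ha, Finset.sum_insert ha, Finset.prod_insert ha, Finset.prod_insert ha,
      hsum, Finset.erase_insert ha]
    have h1 := mul_le_mul_of_nonneg_left ih hma
    have h2 := mul_nonneg (sub_nonneg.2 hUa) (sub_nonneg.2 hprod)
    nlinarith

section Tokens

variable {k : ℕ} {F : Fin k → Type v} [∀ t, Fintype (F t)]

/-- The amount of the flow `f` through the vertex `q`. -/
def flow (f : Path F → ℝ) (q : Node F) : ℝ := ∑ p with Path.Through p q, f p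

theorem flow_nonneg {f : Path F → ℝ} (hf : ∀ p, 0 ≤ f p) (q : Node F) : 0 ≤ flow f q :=
  Finset.sum_nonneg fun p _ => hf p

/-- The probability that a vertex without a token is not opened or has no open vertex of `Q` below
it, given that its father is open and that there are no tokens in its tree. -/
abbrev coinMiss (π : Node F → ℝ) (Q : Node F → Prop) (n : ℕ) (q : Node F) : ℝ :=
  miss (fun _ => False) π Q n q

/-- The probability that the vertex `q` has a token and no open vertex of `Q` below it, when the
path with the token is chosen with probabilities `Y`. -/
def tokenMiss (Y : Path F → ℝ) (π : Node F → ℝ) (Q : Node F → Prop) (n : ℕ) (q : Node F) : ℝ :=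
  ∑ p with Path.Through p q, Y p * missGiven (fun q' => Path.Through p q') π Q n q

/-- The relations between the opening probabilities `x q`, those of the fathers `X q`, the coin
probabilities `π q`, and the probabilities `Y p` with which the tokens choose the path `p`. -/
structure Rounding (x X π : Node F → ℝ) (Y : Path F → ℝ) : Prop where
  token_nonneg : ∀ p, 0 ≤ Y p
  token_le : ∀ q, flow Y q ≤ x q
  open_le_father : ∀ q, x q ≤ X q
  father_eq : ∀ (q : Node F) (h : q.1.1 + 1 < k), X q = x (q.father h)
  father_le_one : ∀ q, X q ≤ 1
  coin_mem : ∀ q, 0 ≤ π q ∧ π q ≤ 1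
  coin_mul : ∀ q, π q * (X q - flow Y q) = x q - flow Y q

theorem miss_of_token {τ : Node F → Prop} {π : Node F → ℝ} {Q : Node F → Prop} {n : ℕ}
    {q : Node F} (h : τ q) : miss τ π Q n q = missGiven τ π Q n q := if_pos h

/-- A path that avoids `q` also avoids the vertices below it. -/
theorem miss_through_of_not {p : Path F} {q : Node F} (hp : ¬ Path.Through p q) (π : Node F → ℝ)
    (Q : Node F → Prop) (n : ℕ) :
    miss (fun q' => Path.Through p q') π Q n q = coinMiss π Q n q := by
  have := missGiven_congr (τ := fun q' => Path.Through p q') (τ' := fun _ => False)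
    (S := fun q => ¬ Path.Through p q)
    (fun q hq q' hq' h => by
      obtain ⟨h', rfl⟩ := mem_children.1 hq'
      exact hq (h.father h'))
    (fun q hq => by simp [hq]) π Q n q hp
  simp only [miss, hp, if_false, coinMiss, this]

theorem tokenMiss_succ (Y : Path F → ℝ) (π : Node F → ℝ) (Q : Node F → Prop) {n : ℕ}
    {q : Node F} (hq : q.1.1 = n + 1) :
    tokenMiss Y π Q (n + 1) q = ∑ q' ∈ children q,
      tokenMiss Y π Q n q' * ∏ q'' ∈ (children q).erase q', coinMiss π Q n q'' := by
  rw [tokenMiss, sum_through_children q hq]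
  refine Finset.sum_congr rfl fun q' hq' => ?_
  rw [tokenMiss, Finset.sum_mul]
  refine Finset.sum_congr rfl fun p hp => ?_
  have hp := (Finset.mem_filter.1 hp).2
  rw [missGiven_succ, ← Finset.mul_prod_erase _ _ hq', miss_of_token hp, mul_assoc]
  congr 2
  refine Finset.prod_congr rfl fun q'' hq'' => miss_through_of_not (fun h => ?_) π Q n
  obtain ⟨hne, hq''⟩ := Finset.mem_erase.1 hq''
  have hl : q''.1 = q'.1 := Fin.ext (by
    have h1 := level_of_mem_children hq''
    have h2 := level_of_mem_children hq'
    omega)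
  exact hne ((Path.node_eq_of_level h hl).symm.trans hp)

theorem flow_children {f : Path F → ℝ} {q : Node F} {n : ℕ} (hq : q.1.1 = n + 1) :
    flow f q = ∑ q' ∈ children q, flow f q' := sum_through_children q hq f

variable {x X π : Node F → ℝ} {Y : Path F → ℝ}

theorem Rounding.tokenMiss_nonneg (R : Rounding x X π Y) (Q : Node F → Prop) (n : ℕ)
    (q : Node F) : 0 ≤ tokenMiss Y π Q n q :=
  Finset.sum_nonneg fun p _ => mul_nonneg (R.token_nonneg p) (missGiven_mem R.coin_mem Q n q).1

theorem Rounding.tokenMiss_le (R : Rounding x X π Y) (Q : Node F → Prop) (n : ℕ)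
    (q : Node F) : tokenMiss Y π Q n q ≤ flow Y q * coinMiss π Q n q := by
  rw [tokenMiss, flow, Finset.sum_mul]
  refine Finset.sum_le_sum fun p _ => mul_le_mul_of_nonneg_left ?_ (R.token_nonneg p)
  exact (missGiven_le_of_imp (τ := fun _ => False) (fun _ h => h.elim) R.coin_mem Q n q).trans
    (miss_mem (R.coin_mem q) (missGiven_mem R.coin_mem Q n q)).1

theorem Rounding.coinMiss_nonneg (R : Rounding x X π Y) (Q : Node F → Prop) (n : ℕ)
    (q : Node F) : 0 ≤ coinMiss π Q n q :=
  (missGiven_mem R.coin_mem Q n q).1.trans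
    (miss_mem (R.coin_mem q) (missGiven_mem R.coin_mem Q n q)).1

/-- The step from a vertex, with opening probability `x`, to its father, with opening probability
`X`. Here `T` and `y` belong to the token, and `v` is the flow through the vertex, which exceeds
`x` only if the opening probability has been capped at `1`. -/
theorem father_step {T x X y π α c v : ℝ} (hv : 0 ≤ v) (hxX : x ≤ X)
    (hX1 : X ≤ 1) (hx0 : 0 ≤ x) (hπ : π * (X - y) = x - y)
    (h : (v ≤ x ∧ T + (x - y) * α ≤ x - c * v) ∨
      (x = 1 ∧ T + (x - y) * α ≤ Real.exp (-(c * v)))) :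
    T + (X - y) * (1 - π * (1 - α)) ≤ X * Real.exp (-(c * v / X)) := by
  have e : T + (X - y) * (1 - π * (1 - α)) = X - x + (T + (x - y) * α) := by
    linear_combination (α - 1) * hπ
  rw [e]
  rcases h with ⟨hvx, h⟩ | ⟨rfl, h⟩
  · rcases (hx0.trans hxX).eq_or_lt with hX | hX
    · have hx : x = 0 := by linarith
      have : v = 0 := by linarith
      subst this
      rw [← hX, hx] at *
      simp at h ⊢
      linarith
    · have h1 := mul_le_mul_of_nonneg_left (Real.add_one_le_exp (-(c * v / X))) hX.le
      have h2 : X * (-(c * v / X) + 1) = X - c * v := by field_simp; ring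
      linarith
  · have : X = 1 := le_antisymm hX1 hxX
    subst this
    simpa using h

/-- With `v` units of flow through a vertex of level `n`, the probability that it is not opened or
has no open vertex of `Q` below it, given that its father is open, is at most
`exp (-rate (n + 1) * v / X)`. -/
theorem Rounding.level_bound (R : Rounding x X π Y) {Q : Node F → Prop} {V : Path F → ℝ}
    (hV : ∀ p, 0 ≤ V p) (hVx : ∀ q, flow V q ≤ x q ∨ x q = 1)
    (hQ : ∀ q : Node F, q.1.1 = 0 → ¬ Q q → flow V q = 0) (n : ℕ) (q : Node F)
    (hq : q.1.1 = n) :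
    tokenMiss Y π Q n q + (X q - flow Y q) * coinMiss π Q n q
      ≤ X q * Real.exp (-(rate (n + 1) * flow V q / X q)) := by
  have hx0 : ∀ q, 0 ≤ x q := fun q => (flow_nonneg R.token_nonneg q).trans (R.token_le q)
  have hv0 : ∀ q, 0 ≤ flow V q := flow_nonneg hV
  have hmiss : ∀ n q, coinMiss π Q n q = 1 - π q * (1 - missGiven (fun _ => False) π Q n q) :=
    fun n q => if_neg id
  induction n generalizing q with
  | zero =>
    rw [hmiss]
    refine father_step (hv0 q) (R.open_le_father q) (R.father_le_one q) (hx0 q)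
      (R.coin_mul q) ?_
    have hrate : rate (0 + 1) = 1 := rfl
    rw [hrate, one_mul]
    by_cases hQq : Q q
    · have hT : tokenMiss Y π Q 0 q = 0 := by simp [tokenMiss, missGiven, hQq]
      simp only [hT, missGiven, hQq, if_true, mul_zero, add_zero]
      rcases hVx q with h | h
      · exact Or.inl ⟨h, by linarith⟩
      · exact Or.inr ⟨h, (Real.exp_pos _).le⟩
    · have hT : tokenMiss Y π Q 0 q = flow Y q := by simp [tokenMiss, missGiven, hQq, flow]
      simp only [hT, missGiven, hQq, if_false, mul_one]
      rw [hQ q hq hQq]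
      exact Or.inl ⟨hx0 q, by linarith⟩
  | succ n ih =>
    rw [hmiss]
    refine father_step (hv0 q) (R.open_le_father q) (R.father_le_one q) (hx0 q)
      (R.coin_mul q) ?_
    rw [missGiven_succ]
    rcases (hx0 q).eq_or_lt with hxq | hxq
    · have hy : flow Y q = 0 :=
        le_antisymm (hxq ▸ R.token_le q) (flow_nonneg R.token_nonneg q)
      have hT : tokenMiss Y π Q (n + 1) q = 0 :=
        le_antisymm (by simpa [hy] using R.tokenMiss_le Q (n + 1) q) (R.tokenMiss_nonneg Q _ q)
      have hv : flow V q = 0 := by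
        rcases hVx q with h | h
        · exact le_antisymm (hxq ▸ h) (hv0 q)
        · linarith
      rw [hT, hy, hv, ← hxq]
      simp
    -- the children are at most as likely to miss as if they were opened independently
    have hXc : ∀ q' ∈ children q, X q' = x q := fun q' hq' => by
      obtain ⟨h', rfl⟩ := mem_children.1 hq'
      exact R.father_eq q' h'
    have hS : tokenMiss Y π Q (n + 1) q + (x q - flow Y q) * ∏ q' ∈ children q, coinMiss π Q n q'
        ≤ x q * Real.exp (-(rate (n + 1) * flow V q / x q)) := by
      have h1 := sum_mul_prod_erase_le (children q) (fun q' => tokenMiss Y π Q n q' / x q)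
        (fun q' => flow Y q' / x q) (fun q' => coinMiss π Q n q')
        (fun q' hq' => by
          rw [div_le_one hxq, ← hXc q' hq']
          exact (R.token_le q').trans (R.open_le_father q'))
        (fun q' _ => R.coinMiss_nonneg Q n q')
        (fun q' _ => div_nonneg (R.tokenMiss_nonneg Q n q') hxq.le)
        (fun q' _ => by
          rw [div_mul_eq_mul_div]
          exact div_le_div_of_nonneg_right (R.tokenMiss_le Q n q') hxq.le)
      have h2 : ∏ q' ∈ children q,
          (tokenMiss Y π Q n q' / x q + (1 - flow Y q' / x q) * coinMiss π Q n q')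
          ≤ ∏ q' ∈ children q, Real.exp (-(rate (n + 1) * flow V q' / x q)) := by
        refine Finset.prod_le_prod (fun q' hq' => ?_) fun q' hq' => ?_
        · refine add_nonneg (div_nonneg (R.tokenMiss_nonneg Q n q') hxq.le)
            (mul_nonneg (sub_nonneg.2 ?_) (R.coinMiss_nonneg Q n q'))
          rw [div_le_one hxq, ← hXc q' hq']
          exact (R.token_le q').trans (R.open_le_father q')
        · have h3 := ih q' (by have := level_of_mem_children hq'; omega)
          rw [hXc q' hq'] at h3
          have e : tokenMiss Y π Q n q' / x q + (1 - flow Y q' / x q) * coinMiss π Q n q'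
              = (tokenMiss Y π Q n q' + (x q - flow Y q') * coinMiss π Q n q') / x q := by
            field_simp
          rw [e, div_le_iff₀ hxq]
          linarith
      rw [← Real.exp_sum] at h2
      have e3 : ∑ q' ∈ children q, -(rate (n + 1) * flow V q' / x q)
          = -(rate (n + 1) * flow V q / x q) := by
        rw [flow_children hq, Finset.sum_neg_distrib, ← Finset.sum_div, ← Finset.mul_sum]
      rw [e3] at h2
      have h4 := mul_le_mul_of_nonneg_left (h1.trans h2) hxq.le
      refine le_trans (le_of_eq ?_) h4
      rw [tokenMiss_succ Y π Q hq, flow_children hq, mul_add, Finset.mul_sum, ← Finset.sum_div]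
      congr 1
      · exact Finset.sum_congr rfl fun q' _ => by field_simp
      · field_simp
    rcases hVx q with h | h
    · refine Or.inl ⟨h, hS.trans ?_⟩
      have h1 := exp_mul_le_chord (div_nonneg (hv0 q) hxq.le) ((div_le_one hxq).2 h)
        (-rate (n + 1))
      have e1 : -(rate (n + 1) * flow V q / x q) = flow V q / x q * -rate (n + 1) := by ring
      rw [e1]
      refine (mul_le_mul_of_nonneg_left h1 hxq.le).trans (le_of_eq ?_)
      have e2 : rate (n + 1 + 1) = 1 - Real.exp (-rate (n + 1)) := rfl
      rw [e2]
      field_simp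
      ring
    · refine Or.inr ⟨h, hS.trans ?_⟩
      rw [h, one_mul, div_one]
      exact Real.exp_le_exp.2 (neg_le_neg (mul_le_mul_of_nonneg_right (rate_succ_le n) (hv0 q)))

end Tokens

/-! ### The tokens of several centers -/

section Centers

variable {k : ℕ} [NeZero k] {F : Fin k → Type v} [∀ t, Fintype (F t)]

theorem mem_roots_node (p : Path F) : Path.node p (topLevel k) ∈ levelNodes F (k - 1) :=
  mem_levelNodes.2 rfl

theorem node_topLevel_eq_iff {p : Path F} {r : Node F} (hr : r ∈ levelNodes F (k - 1)) :
    Path.node p (topLevel k) = r ↔ Path.Through p r := by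
  constructor
  · rintro rfl
    rfl
  · exact fun h => Path.node_eq_of_level h (Fin.ext (mem_levelNodes.1 hr))

/-- Every path ends in exactly one root. -/
theorem sum_flow_roots (f : Path F → ℝ) : ∑ r ∈ levelNodes F (k - 1), flow f r = ∑ p, f p := by
  rw [← Finset.sum_fiberwise_of_maps_to fun p _ => mem_roots_node p]
  exact Finset.sum_congr rfl fun r hr => Finset.sum_congr
    (Finset.filter_congr fun p _ => (node_topLevel_eq_iff hr).symm) fun _ _ => rfl

/-- A sum over paths that end in a given set of roots. -/
theorem sum_eq_sum_roots (S : Finset (Node F)) (hS : S ⊆ levelNodes F (k - 1)) (g : Path F → ℝ)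
    (hg : ∀ p, g p ≠ 0 → Path.node p (topLevel k) ∈ S) :
    ∑ p, g p = ∑ r ∈ S, ∑ p with Path.Through p r, g p := by
  rw [← sum_flow_roots g]
  refine (Finset.sum_subset hS fun r hr hrS => Finset.sum_eq_zero fun p hp => ?_).symm
  by_contra hne
  have := (node_topLevel_eq_iff hr).2 (Finset.mem_filter.1 hp).2
  exact hrS (this ▸ hg p hne)

variable {ι : Type*} [Fintype ι] {x X π : Node F → ℝ} {cl : ι → Path F → ℝ}

/-- If the centers choose their token paths independently and in different trees, then the
probability that all trees miss `Q` is bounded by the product of the averages for the trees. -/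
theorem Rounding.prodExpect_tokens_le (R : Rounding x X π fun p => ∑ c, cl c p)
    (hcl : ∀ c p, 0 ≤ cl c p) (hsum : ∀ c, ∑ p, cl c p = 1)
    (hdisj : ∀ c c' p p', 0 < cl c p → 0 < cl c' p' → p (topLevel k) = p' (topLevel k) → c = c')
    (hroot : ∀ r ∈ levelNodes F (k - 1), X r = 1) (Q : Node F → Prop) :
    prodExpect cl (fun T => ∏ r ∈ levelNodes F (k - 1),
        miss (fun q => ∃ c, Path.Through (T c) q) π Q (k - 1) r) ≤
      ∏ r ∈ levelNodes F (k - 1), (tokenMiss (fun p => ∑ c, cl c p) π Q (k - 1) r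
        + (1 - flow (fun p => ∑ c, cl c p) r) * coinMiss π Q (k - 1) r) := by
  set Y : Path F → ℝ := fun p => ∑ c, cl c p with hY
  have hroots : ∀ (r : Node F), r ∈ levelNodes F (k - 1) → flow Y r ≤ 1 := fun r hr =>
    hroot r hr ▸ (R.token_le r).trans (R.open_le_father r)
  -- the center, if any, whose token may be in the tree of `r`
  obtain ⟨owner, howner⟩ : ∃ owner : Node F → Option ι,
      ∀ r c, owner r = some c ↔ ∃ p, 0 < cl c p ∧ r.top = p (topLevel k) := by
    refine ⟨fun r => if h : ∃ c p, 0 < cl c p ∧ r.top = p (topLevel k) then some h.choose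
      else none, fun r c => ?_⟩
    dsimp only
    split_ifs with h
    · constructor
      · intro he
        rw [← Option.some.inj he]
        exact h.choose_spec
      · rintro ⟨p, hp, hpr⟩
        obtain ⟨p', hp', hpr'⟩ := h.choose_spec
        exact congrArg some (hdisj _ _ _ _ hp' hp (hpr'.symm.trans hpr))
    · exact ⟨fun he => by simp at he, fun ⟨p, hp⟩ => (h ⟨c, p, hp⟩).elim⟩
  have hzero : ∀ r c p, owner r ≠ some c → r.top = p (topLevel k) → cl c p = 0 :=
    fun r c p hr hp => le_antisymm (not_lt.1 fun hlt => hr ((howner r c).2 ⟨p, hlt, hp⟩)) (hcl c p)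
  have hsub : ∀ o, (levelNodes F (k - 1)).filter (fun r => owner r = o) ⊆ levelNodes F (k - 1) :=
    fun o => Finset.filter_subset _ _
  -- the trees without a token
  have hnone : ∀ r ∈ levelNodes F (k - 1), owner r = none →
      tokenMiss Y π Q (k - 1) r + (1 - flow Y r) * coinMiss π Q (k - 1) r
        = coinMiss π Q (k - 1) r := fun r hr ho => by
    have hp : ∀ p, Path.Through p r → Y p = 0 := fun p hp =>
      Finset.sum_eq_zero fun c _ => hzero r c p (by simp [ho]) hp.top_eq
    have h1 : flow Y r = 0 :=
      Finset.sum_eq_zero fun p hp' => hp p (Finset.mem_filter.1 hp').2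
    have h2 : tokenMiss Y π Q (k - 1) r = 0 :=
      Finset.sum_eq_zero fun p hp' => by rw [hp p (Finset.mem_filter.1 hp').2, zero_mul]
    rw [h1, h2]
    ring
  -- the trees of a center
  have hsome : ∀ c, ∑ p, cl c p * ∏ r ∈ levelNodes F (k - 1) with owner r = some c,
        miss (fun q => Path.Through p q) π Q (k - 1) r ≤
      ∏ r ∈ levelNodes F (k - 1) with owner r = some c,
        (tokenMiss Y π Q (k - 1) r + (1 - flow Y r) * coinMiss π Q (k - 1) r) := fun c => by
    set S := (levelNodes F (k - 1)).filter fun r => owner r = some c with hS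
    have hYc : ∀ r ∈ S, ∀ p, Path.Through p r → Y p = cl c p := fun r hr p hp => by
      refine Finset.sum_eq_single c (fun c' _ hc' => hzero r c' p ?_ hp.top_eq) (by simp)
      rw [(Finset.mem_filter.1 hr).2]
      exact fun h => hc' (Option.some.inj h).symm
    have hmem : ∀ p, cl c p ≠ 0 → Path.node p (topLevel k) ∈ S := fun p hp =>
      Finset.mem_filter.2 ⟨mem_roots_node p,
        (howner _ _).2 ⟨p, lt_of_le_of_ne (hcl c p) (Ne.symm hp), rfl⟩⟩
    have hflow : ∑ r ∈ S, flow Y r = 1 := by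
      rw [← hsum c, sum_eq_sum_roots S (hsub _) (cl c) hmem]
      exact Finset.sum_congr rfl fun r hr => Finset.sum_congr rfl fun p hp =>
        hYc r hr p (Finset.mem_filter.1 hp).2
    have h1 := sum_mul_prod_erase_le S (tokenMiss Y π Q (k - 1)) (flow Y)
      (coinMiss π Q (k - 1)) (fun r hr => hroots r (hsub _ hr))
      (fun r _ => R.coinMiss_nonneg Q _ r) (fun r _ => R.tokenMiss_nonneg Q _ r)
      (fun r _ => R.tokenMiss_le Q _ r)
    rw [hflow, sub_self, zero_mul, add_zero] at h1
    refine le_trans (le_of_eq ?_) h1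
    rw [sum_eq_sum_roots S (hsub _) _ fun p hp => hmem p (left_ne_zero_of_mul hp)]
    refine Finset.sum_congr rfl fun r hr => ?_
    rw [tokenMiss, Finset.sum_mul]
    refine Finset.sum_congr rfl fun p hp => ?_
    have hp := (Finset.mem_filter.1 hp).2
    rw [← Finset.mul_prod_erase _ _ hr, miss_of_token hp, hYc r hr p hp, mul_assoc]
    congr 2
    refine Finset.prod_congr rfl fun r' hr' => miss_through_of_not (fun h => ?_) π Q _
    obtain ⟨hne, hr'⟩ := Finset.mem_erase.1 hr'
    exact hne (((node_topLevel_eq_iff (hsub _ hr')).2 h).symm.trans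
      ((node_topLevel_eq_iff (hsub _ hr)).2 hp))
  have hsplit : ∀ f : Node F → ℝ, ∏ r ∈ levelNodes F (k - 1), f r
      = (∏ r ∈ levelNodes F (k - 1) with owner r = none, f r)
        * ∏ c, ∏ r ∈ levelNodes F (k - 1) with owner r = some c, f r := fun f => by
    rw [← Finset.prod_fiberwise (levelNodes F (k - 1)) owner f, Fintype.prod_option]
  rw [hsplit]
  calc prodExpect cl (fun T => ∏ r ∈ levelNodes F (k - 1),
        miss (fun q => ∃ c, Path.Through (T c) q) π Q (k - 1) r)
      ≤ prodExpect cl (fun T =>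
        (∏ r ∈ levelNodes F (k - 1) with owner r = none, coinMiss π Q (k - 1) r) *
        ∏ c, ∏ r ∈ levelNodes F (k - 1) with owner r = some c,
          miss (fun q => Path.Through (T c) q) π Q (k - 1) r) := by
        refine prodExpect_mono hcl fun T hT => le_of_eq ?_
        rw [hsplit]
        have htree : ∀ (τ : Node F → Prop) (r : Node F),
            (∀ q : Node F, q.top = r.top → ((∃ c, Path.Through (T c) q) ↔ τ q)) →
            miss (fun q => ∃ c, Path.Through (T c) q) π Q (k - 1) r
              = miss τ π Q (k - 1) r := fun τ r hτ => by
          have h1 := missGiven_congr (S := fun q => q.top = r.top)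
            (fun q hq q' hq' => by
              obtain ⟨h', rfl⟩ := mem_children.1 hq'
              exact hq) hτ π Q (k - 1) r rfl
          simp only [miss, h1]
          exact if_congr (hτ r rfl) rfl rfl
        congr 1
        · refine Finset.prod_congr rfl fun r hr => htree _ r fun q hq => ?_
          refine iff_false_intro ?_
          rintro ⟨c, hc⟩
          have := (howner r c).2 ⟨T c, hT c, hq ▸ hc.top_eq⟩
          rw [(Finset.mem_filter.1 hr).2] at this
          exact Option.some_ne_none c this.symm
        · refine Finset.prod_congr rfl fun c _ => Finset.prod_congr rfl fun r hr =>
            htree _ r fun q hq => ⟨?_, fun h => ⟨c, h⟩⟩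
          rintro ⟨c', hc'⟩
          have := (howner r c').2 ⟨T c', hT c', hq ▸ hc'.top_eq⟩
          rw [(Finset.mem_filter.1 hr).2] at this
          rwa [Option.some.inj this]
    _ = (∏ r ∈ levelNodes F (k - 1) with owner r = none, coinMiss π Q (k - 1) r) *
        ∏ c, ∑ p, cl c p * ∏ r ∈ levelNodes F (k - 1) with owner r = some c,
          miss (fun q => Path.Through p q) π Q (k - 1) r := by
        rw [prodExpect_const_mul, prodExpect_prod cl fun c p =>
          ∏ r ∈ levelNodes F (k - 1) with owner r = some c,
            miss (fun q => Path.Through p q) π Q (k - 1) r]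
    _ ≤ _ := by
        refine mul_le_mul (le_of_eq ?_) (Finset.prod_le_prod (fun c _ => ?_) fun c _ => hsome c)
          (Finset.prod_nonneg fun c _ => ?_) (Finset.prod_nonneg fun r hr => ?_)
        · exact Finset.prod_congr rfl fun r hr =>
            (hnone r (hsub _ hr) (Finset.mem_filter.1 hr).2).symm
        · exact Finset.sum_nonneg fun p _ => mul_nonneg (hcl c p) (Finset.prod_nonneg fun r _ =>
            (missGiven_mem R.coin_mem Q _ r).1.trans
              (miss_mem (R.coin_mem r) (missGiven_mem R.coin_mem Q _ r)).1)
        · exact Finset.sum_nonneg fun p _ => mul_nonneg (hcl c p) (Finset.prod_nonneg fun r _ =>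
            (missGiven_mem R.coin_mem Q _ r).1.trans
              (miss_mem (R.coin_mem r) (missGiven_mem R.coin_mem Q _ r)).1)
        · exact add_nonneg (R.tokenMiss_nonneg Q _ r) (mul_nonneg
            (sub_nonneg.2 (hroots r (hsub _ hr))) (R.coinMiss_nonneg Q _ r))

/-- With flow `V`, the probability that no path in `Q` is open is at most
`exp (-rate k * ∑ p, V p)`, which is `1 - F_k` at the amount of the flow. -/
theorem Rounding.prodExpect_no_path_le (R : Rounding x X π fun p => ∑ c, cl c p)
    (hcl : ∀ c p, 0 ≤ cl c p) (hsum : ∀ c, ∑ p, cl c p = 1)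
    (hdisj : ∀ c c' p p', 0 < cl c p → 0 < cl c' p' → p (topLevel k) = p' (topLevel k) → c = c')
    (hroot : ∀ r ∈ levelNodes F (k - 1), X r = 1) {V : Path F → ℝ} (hV : ∀ p, 0 ≤ V p)
    (hVx : ∀ q, flow V q ≤ x q ∨ x q = 1) (Q : Path F → Prop) (hQ : ∀ p, ¬ Q p → V p = 0) :
    prodExpect cl (fun T => prodExpect (coinWeight π) (fun b =>
        if ∃ p, Q p ∧ OpenBy (fun q => ∃ c, Path.Through (T c) q) b (Path.node p 0)
          then 0 else 1)) ≤ Real.exp (-(rate k * ∑ p, V p)) := by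
  obtain ⟨Q', hQ'⟩ : ∃ Q' : Node F → Prop, ∀ q, Q' q ↔ ∃ p, Q p ∧ Path.node p 0 = q :=
    ⟨_, fun _ => Iff.rfl⟩
  have hcoins : ∀ T : ι → Path F, prodExpect (coinWeight π) (fun b =>
        if ∃ p, Q p ∧ OpenBy (fun q => ∃ c, Path.Through (T c) q) b (Path.node p 0)
          then 0 else 1) = ∏ r ∈ levelNodes F (k - 1),
        miss (fun q => ∃ c, Path.Through (T c) q) π Q' (k - 1) r := fun T => by
    rw [← prodExpect_miss _ π Q' fun q h ⟨c, hc⟩ => ⟨c, hc.father h⟩]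
    congr 1
    funext b
    refine if_congr ⟨?_, ?_⟩ rfl rfl
    · rintro ⟨p, hp, ho⟩
      exact ⟨_, mem_levelNodes.2 rfl, (hQ' _).2 ⟨p, hp, rfl⟩, ho⟩
    · rintro ⟨q, -, hq, ho⟩
      obtain ⟨p, hp, rfl⟩ := (hQ' q).1 hq
      exact ⟨p, hp, ho⟩
  simp only [hcoins]
  refine (R.prodExpect_tokens_le hcl hsum hdisj hroot Q').trans ?_
  rw [← sum_flow_roots V, Finset.mul_sum, ← Finset.sum_neg_distrib, Real.exp_sum]
  refine Finset.prod_le_prod (fun r hr => ?_) fun r hr => ?_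
  · exact add_nonneg (R.tokenMiss_nonneg Q' _ r) (mul_nonneg (sub_nonneg.2
      (hroot r hr ▸ (R.token_le r).trans (R.open_le_father r))) (R.coinMiss_nonneg Q' _ r))
  · have h := R.level_bound (Q := Q') hV hVx (fun q hq hqQ => ?_) (k - 1) r (mem_levelNodes.1 hr)
    · rw [hroot r hr, one_mul, div_one, Nat.sub_add_cancel (NeZero.pos k)] at h
      exact h
    · refine Finset.sum_eq_zero fun p hp => hQ p fun hQp => hqQ ((hQ' q).2 ⟨p, hQp, ?_⟩)
      exact Path.node_eq_of_level (Finset.mem_filter.1 hp).2 (Fin.ext hq)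

end Centers

/-! ### The greedy clustering -/

theorem Neighbor.symm {k : ℕ} {C : Type u} {F : Fin k → Type v} {close : C → Path F → ℝ}
    {j₁ j₂ : C} (h : Neighbor close j₁ j₂) :
    Neighbor close j₂ j₁ := by
  obtain ⟨p₁, p₂, h1, h2, h3⟩ := h
  exact ⟨p₂, p₁, h2, h1, fun t ht => (h3 t ht).symm⟩

section Clustering

variable {k : ℕ} [NeZero k] {C : Type u} {F : Fin k → Type v} {X : Type w}
  [PseudoMetricSpace X] [∀ t, Fintype (F t)] {I : Instance k C F X}

/-- The outcome of the greedy clustering: the center of a client is the client itself or a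
neighbour that is at most as expensive, and different centers are not neighbours. -/
theorem ClusterRun.spec {close : C → Path F → ℝ} {U : Finset C} {center : C → C}
    (h : ClusterRun I close U center) :
    (∀ j ∈ U, center j ∈ U ∧ (j = center j ∨ Neighbor close (center j) j) ∧
      closeAvg I close (center j) + closeMax I close (center j)
        ≤ closeAvg I close j + closeMax I close j) ∧
    ∀ i ∈ U, ∀ j ∈ U, Neighbor close (center i) (center j) → center i = center j := by
  induction h with
  | done => simp
  | step U center j hj hmin hcluster _ ih =>
    obtain ⟨ih1, ih2⟩ := ih
    have hcases : ∀ i ∈ U, center i = j ∧ (i = j ∨ Neighbor close j i) ∨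
        i ∈ U.filter fun i => ¬(i = j ∨ Neighbor close j i) := fun i hi => by
      by_cases hc : i = j ∨ Neighbor close j i
      · exact Or.inl ⟨hcluster i hi hc, hc⟩
      · exact Or.inr (Finset.mem_filter.2 ⟨hi, hc⟩)
    have hrest : ∀ i ∈ U.filter (fun i => ¬(i = j ∨ Neighbor close j i)),
        ¬ Neighbor close j (center i) := fun i hi hn =>
      (Finset.mem_filter.1 (ih1 i hi).1).2 (Or.inr hn)
    refine ⟨fun i hi => ?_, fun i hi i' hi' hn => ?_⟩
    · rcases hcases i hi with ⟨hc, hn⟩ | hr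
      · rw [hc]
        exact ⟨hj, hn, hmin i hi⟩
      · obtain ⟨h1, h2⟩ := ih1 i hr
        exact ⟨(Finset.mem_filter.1 h1).1, h2⟩
    · rcases hcases i hi with ⟨hc, -⟩ | hr <;> rcases hcases i' hi' with ⟨hc', -⟩ | hr'
      · rw [hc, hc']
      · exact (hrest i' hr' (hc ▸ hn)).elim
      · exact (hrest i hr (hc' ▸ hn.symm)).elim
      · exact ih2 i hr i' hr' hn

end Clustering

/-! ### The rounding of a run -/

namespace Run

variable {k : ℕ} [NeZero k] {C : Type u} {F : Fin k → Type v} {X : Type w}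
  [PseudoMetricSpace X] [Fintype C] [∀ t, Fintype (F t)] {I : Instance k C F X} {γ : ℝ}
  (R : Run I γ)

theorem center_mem {j : C} (hj : j ∈ bigClients R.sol γ) : R.center j ∈ R.centers :=
  Finset.mem_image_of_mem _ hj

theorem centers_subset : R.centers ⊆ bigClients R.sol γ := fun c hc => by
  obtain ⟨j, hj, rfl⟩ := Finset.mem_image.1 hc
  exact (R.center_clusterRun.spec.1 j hj).1

theorem isClosePart_of_mem_centers {c : C} (hc : c ∈ R.centers) :
    IsClosePart I c (R.xbar c) (R.close c) :=
  R.close_isClosePart c (R.centers_subset hc)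

/-- The probability that the token of the center `c` travels down the path `p`. -/
def tokenWeight (c : {c // c ∈ R.centers}) (p : Path F) : ℝ := R.close c.1 p

theorem tokenWeight_nonneg (c : {c // c ∈ R.centers}) (p : Path F) : 0 ≤ R.tokenWeight c p :=
  (R.isClosePart_of_mem_centers c.2).nonneg p

theorem sum_tokenWeight (c : {c // c ∈ R.centers}) : ∑ p, R.tokenWeight c p = 1 :=
  (R.isClosePart_of_mem_centers c.2).volume

/-- The tokens of different centers are in different trees. -/
theorem eq_of_same_tree {c c' : {c // c ∈ R.centers}} {p p' : Path F}
    (hp : 0 < R.tokenWeight c p) (hp' : 0 < R.tokenWeight c' p')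
    (h : p (topLevel k) = p' (topLevel k)) : c = c' := by
  obtain ⟨j, hj, hjc⟩ := Finset.mem_image.1 c.2
  obtain ⟨j', hj', hjc'⟩ := Finset.mem_image.1 c'.2
  refine Subtype.ext ?_
  rw [← hjc, ← hjc']
  refine R.center_clusterRun.spec.2 j hj j' hj' ?_
  rw [hjc, hjc']
  refine ⟨p, p', hp, hp', fun t ht => ?_⟩
  have : t = topLevel k := Fin.ext (Nat.eq_sub_of_add_eq ht)
  rw [this]
  exact h

theorem centerUsage_eq (q : Node F) :
    R.centerUsage q = flow (fun p => ∑ c, R.tokenWeight c p) q := by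
  unfold centerUsage flow tokenWeight
  rw [Finset.sum_comm]
  exact Finset.sum_congr rfl fun p _ => (Finset.sum_coe_sort R.centers fun c => R.close c p).symm

theorem vertexProb_nonneg (hγ : 0 ≤ γ) (q : Node F) : 0 ≤ R.vertexProb q :=
  le_min zero_le_one (mul_nonneg hγ (R.sol_optimal.1.opening_nonneg q))

theorem vertexProb_le_fatherProb (hγ : 0 ≤ γ) (q : Node F) :
    R.vertexProb q ≤ R.fatherProb q := by
  unfold fatherProb
  split_ifs with h
  · exact min_le_min le_rfl
      (mul_le_mul_of_nonneg_left (R.sol_optimal.1.opening_le_father q h) hγ)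
  · exact min_le_left _ _

theorem fatherProb_le_one (q : Node F) : R.fatherProb q ≤ 1 := by
  unfold fatherProb
  split_ifs with h
  · exact min_le_left _ _
  · exact le_rfl

theorem fatherProb_root {q : Node F} (hq : q ∈ levelNodes F (k - 1)) : R.fatherProb q = 1 :=
  dif_neg (by have := mem_levelNodes.1 hq; have := NeZero.pos k; omega)

/-- At most one center uses the tree of `q`, and its close flow respects the capacity of `q`. -/
theorem centerUsage_le (hγ : 0 ≤ γ) (q : Node F) : R.centerUsage q ≤ R.vertexProb q := by
  by_cases h : ∃ c : {c // c ∈ R.centers}, ∃ p, Path.Through p q ∧ 0 < R.tokenWeight c p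
  · obtain ⟨c, p, hp, hcp⟩ := h
    have h1 : R.centerUsage q = flow (R.close c.1) q := by
      rw [centerUsage_eq]
      refine Finset.sum_congr rfl fun p' hp' => Finset.sum_eq_single c (fun c' _ hne => ?_) (by simp)
      refine le_antisymm (not_lt.1 fun hlt => hne ?_) (R.tokenWeight_nonneg c' p')
      exact R.eq_of_same_tree hlt hcp
        ((Finset.mem_filter.1 hp').2.top_eq.symm.trans hp.top_eq)
    have hc := R.isClosePart_of_mem_centers c.2
    rw [h1]
    refine le_min ?_ ?_
    · rw [← hc.volume]
      exact Finset.sum_le_sum_of_subset_of_nonneg (Finset.filter_subset _ _)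
        fun p _ _ => hc.nonneg p
    · exact (Finset.sum_le_sum fun p _ => hc.le p).trans
        (R.xbar_recomputed.1.usage_le_opening c.1 q)
  · push Not at h
    rw [centerUsage_eq]
    refine le_trans (le_of_eq ?_) (R.vertexProb_nonneg hγ q)
    exact Finset.sum_eq_zero fun p hp => Finset.sum_eq_zero fun c _ =>
      le_antisymm (h c p (Finset.mem_filter.1 hp).2) (R.tokenWeight_nonneg c p)

theorem rounding (hγ : 0 ≤ γ) :
    Rounding R.vertexProb R.fatherProb R.coinProb fun p => ∑ c, R.tokenWeight c p where
  token_nonneg p := Finset.sum_nonneg fun c _ => R.tokenWeight_nonneg c p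
  token_le q := R.centerUsage_eq q ▸ R.centerUsage_le hγ q
  open_le_father := R.vertexProb_le_fatherProb hγ
  father_eq q h := dif_pos h
  father_le_one := R.fatherProb_le_one
  coin_mem q := by
    have h1 := R.centerUsage_le hγ q
    have h2 := R.vertexProb_le_fatherProb hγ q
    exact ⟨div_nonneg (by linarith) (by linarith), div_le_one_of_le₀ (by linarith) (by linarith)⟩
  coin_mul q := by
    rw [← centerUsage_eq]
    have h1 := R.centerUsage_le hγ q
    have h2 := R.vertexProb_le_fatherProb hγ q
    -- where the denominator of `coinProb` vanishes, so does the numerator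
    rcases eq_or_ne (R.fatherProb q - R.centerUsage q) 0 with h | h
    · rw [h, mul_zero]
      linarith
    · exact div_mul_cancel₀ _ h

/-- The vertices that receive a token. -/
def Token (T : {c // c ∈ R.centers} → Path F) (q : Node F) : Prop := ∃ c, Path.Through (T c) q

theorem Token.father {T : {c // c ∈ R.centers} → Path F} (q : Node F) (h : q.1.1 + 1 < k)
    (hq : R.Token T q) : R.Token T (q.father h) := by
  obtain ⟨c, hc⟩ := hq
  exact ⟨c, hc.father h⟩

theorem opened_iff (ω : R.Outcome) (q : Node F) :
    R.Opened ω q ↔ OpenBy (R.Token ω.1) ω.2 q := by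
  constructor
  · intro h
    induction h with
    | token q c h => exact .token q ⟨c, h⟩
    | root q hq hc => exact .coin q hc fun h => (hq h).elim
    | child q hq _ hc ih => exact .coin q hc fun _ => ih
  · intro h
    induction h with
    | token q h => exact h.elim fun c hc => .token q c hc
    | coin q hc _ ih =>
      by_cases hq : q.1.1 + 1 < k
      · exact .child q hq (ih hq) hc
      · exact .root q hq hc

/-- The tokens are drawn first, then the coins are tossed. -/
theorem expect_eq (f : R.Outcome → ℝ) :
    R.expect f = prodExpect R.tokenWeight
      (fun T => prodExpect (coinWeight R.coinProb) (fun b => f (T, b))) := by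
  unfold expect prodExpect
  rw [Fintype.sum_prod_type]
  refine Finset.sum_congr (by congr!) fun T _ => ?_
  rw [Finset.mul_sum]
  refine Finset.sum_congr (by congr!) fun b _ => ?_
  rw [← mul_assoc]
  congr 1

theorem coinWeight_nonneg (hγ : 0 ≤ γ) (q : Node F) (b : Bool) :
    0 ≤ coinWeight R.coinProb q b := by
  have := (R.rounding hγ).coin_mem q
  cases b <;> simp [coinWeight, this.1, this.2]

theorem expect_mono (hγ : 0 ≤ γ) {f g : R.Outcome → ℝ}
    (h : ∀ ω : R.Outcome, (∀ c, 0 < R.tokenWeight c (ω.1 c)) → f ω ≤ g ω) :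
    R.expect f ≤ R.expect g := by
  rw [expect_eq, expect_eq]
  exact prodExpect_mono R.tokenWeight_nonneg fun T hT =>
    prodExpect_mono (R.coinWeight_nonneg hγ) fun b _ => h (T, b) hT

theorem prob_nonneg (hγ : 0 ≤ γ) (ω : R.Outcome) : 0 ≤ R.prob ω :=
  mul_nonneg (Finset.prod_nonneg fun c _ => R.tokenWeight_nonneg c _)
    (Finset.prod_nonneg fun q _ => R.coinWeight_nonneg hγ q _)

theorem expect_add (f g : R.Outcome → ℝ) :
    R.expect (fun ω => f ω + g ω) = R.expect f + R.expect g := by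
  simp [expect, mul_add, Finset.sum_add_distrib]

theorem expect_sum {κ : Type*} (s : Finset κ) (f : κ → R.Outcome → ℝ) :
    R.expect (fun ω => ∑ x ∈ s, f x ω) = ∑ x ∈ s, R.expect (f x) := by
  simp only [expect, Finset.mul_sum]
  exact Finset.sum_comm

theorem expect_mul_const (r : ℝ) (f : R.Outcome → ℝ) :
    R.expect (fun ω => f ω * r) = R.expect f * r := by
  simp only [expect, Finset.sum_mul]
  exact Finset.sum_congr rfl fun ω _ => by ring

/-! ### The facility cost -/

theorem expect_token_le (q : Node F) :
    prodExpect R.tokenWeight (fun T => if R.Token T q then 1 else 0) ≤ R.centerUsage q := by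
  calc prodExpect R.tokenWeight (fun T => if R.Token T q then 1 else 0)
      ≤ prodExpect R.tokenWeight
          (fun T => ∑ c, if Path.Through (T c) q then (1 : ℝ) else 0) := by
        refine prodExpect_mono R.tokenWeight_nonneg fun T _ => ?_
        have hnn : ∀ c, 0 ≤ if Path.Through (T c) q then (1 : ℝ) else 0 := fun c => by
          split_ifs <;> norm_num
        split_ifs with h
        · obtain ⟨c, hc⟩ := h
          have := Finset.single_le_sum (fun c _ => hnn c) (Finset.mem_univ c)
          rwa [if_pos hc] at this
        · exact Finset.sum_nonneg fun c _ => hnn c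
    _ = R.centerUsage q := by
        rw [prodExpect_sum, centerUsage_eq, flow, Finset.sum_comm]
        refine Finset.sum_congr rfl fun c _ => ?_
        rw [prodExpect_apply R.sum_tokenWeight c fun p => if Path.Through p q then (1 : ℝ) else 0,
          Finset.sum_filter]
        exact Finset.sum_congr rfl fun p _ => by simp

/-- Given the tokens, a vertex without a token is open if its coin succeeds and, independently,
its father is open. -/
theorem prodExpect_open (T : {c // c ∈ R.centers} → Path F) (q : Node F) :
    prodExpect (coinWeight R.coinProb)
        (fun b => if OpenBy (R.Token T) b q then (1 : ℝ) else 0) =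
      (if R.Token T q then 1 else 0) + R.coinProb q * (prodExpect (coinWeight R.coinProb)
        (fun b => if ∀ h : q.1.1 + 1 < k, OpenBy (R.Token T) b (q.father h) then (1 : ℝ) else 0)
          - if R.Token T q then 1 else 0) := by
  by_cases ht : R.Token T q
  · have h1 : ∀ b, OpenBy (R.Token T) b q := fun b => .token q ht
    have h2 : ∀ b, ∀ h : q.1.1 + 1 < k, OpenBy (R.Token T) b (q.father h) :=
      fun b h => .token _ (Token.father R q h ht)
    simp only [h1, h2, ht, if_true, implies_true]
    rw [prodExpect_const (sum_coinWeight _)]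
    ring
  · rw [prodExpect_update q (sum_coinWeight _ q), if_neg ht, zero_add, sub_zero,
      ← prodExpect_const_mul]
    congr 1
    funext b
    have hq : ∀ a, OpenBy (R.Token T)
        (@Function.update _ _ (fun x y => Classical.propDecidable (x = y)) b q a) q ↔
        (a = true ∧ ∀ h : q.1.1 + 1 < k, OpenBy (R.Token T) b (q.father h)) := fun a => by
      have hself : @Function.update _ _ (fun x y => Classical.propDecidable (x = y)) b q a q = a :=
        dif_pos rfl
      rw [openBy_iff, hself]
      simp only [ht, false_or]
      exact and_congr Iff.rfl (forall_congr' fun h =>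
        openBy_iff_of_eq_off (fun q' hq' => dif_neg hq') (Nat.lt_succ_self _))
    simp only [hq, Fintype.sum_bool, coinWeight]
    by_cases hf : ∀ h : q.1.1 + 1 < k, OpenBy (R.Token T) b (q.father h)
    · simp [hf]
    · simp [hf]

theorem expect_opened_le (hγ : 0 ≤ γ) (q : Node F) :
    R.expect (fun ω => if R.Opened ω q then 1 else 0) ≤ R.vertexProb q := by
  -- induction from the roots down: `n` is the number of levels above that of `q`
  have key : ∀ (n : ℕ) (q : Node F), q.1.1 + 1 + n = k → prodExpect R.tokenWeight
      (fun T => prodExpect (coinWeight R.coinProb)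
        (fun b => if OpenBy (R.Token T) b q then (1 : ℝ) else 0)) ≤ R.vertexProb q := by
    intro n
    induction n with
    | zero =>
      intro q hq
      have hnot : ¬ q.1.1 + 1 < k := by omega
      simp only [fun T => R.prodExpect_open T q, hnot, IsEmpty.forall_iff, if_true,
        prodExpect_const (sum_coinWeight R.coinProb)]
      have hx := (R.rounding hγ).coin_mem q
      refine prob_open_step hx.1 hx.2 ((R.rounding hγ).coin_mul q) (O := 1)
        (t := prodExpect R.tokenWeight (fun T => if R.Token T q then 1 else 0)) ?_ ?_ ?_
      · rw [fatherProb, dif_neg hnot]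
      · rw [← centerUsage_eq]
        exact R.expect_token_le q
      · rw [prodExpect_add, prodExpect_const_mul]
        rw [prodExpect_sub, prodExpect_const R.sum_tokenWeight]
    | succ n ih =>
      intro q hq
      have hlt : q.1.1 + 1 < k := by omega
      simp only [fun T => R.prodExpect_open T q, hlt, forall_true_left]
      have hx := (R.rounding hγ).coin_mem q
      refine prob_open_step hx.1 hx.2 ((R.rounding hγ).coin_mul q)
        (O := prodExpect R.tokenWeight (fun T => prodExpect (coinWeight R.coinProb)
          (fun b => if OpenBy (R.Token T) b (q.father hlt) then (1 : ℝ) else 0)))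
        (t := prodExpect R.tokenWeight (fun T => if R.Token T q then 1 else 0)) ?_ ?_ ?_
      · rw [fatherProb, dif_pos hlt]
        refine ih (q.father hlt) ?_
        have : (q.father hlt).1.1 = q.1.1 + 1 := rfl
        omega
      · rw [← centerUsage_eq]
        exact R.expect_token_le q
      · rw [prodExpect_add, prodExpect_const_mul]
        rw [prodExpect_sub]
  rw [expect_eq]
  simp only [R.opened_iff]
  exact key (k - (q.1.1 + 1)) q (Nat.add_sub_cancel' q.1.2)

/-- A facility is paid for at most once for every open copy. -/
theorem facilityCost_le (ω : R.Outcome) :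
    R.facilityCost ω
      ≤ ∑ q : Node F, (if R.Opened ω q then 1 else 0) * I.openCost q.1 q.facility := by
  have hnn : ∀ q : Node F, 0 ≤ (if R.Opened ω q then (1 : ℝ) else 0) * I.openCost q.1 q.facility :=
    fun q => mul_nonneg (by split_ifs <;> norm_num) (I.openCost_nonneg _ _)
  unfold facilityCost
  rw [← Fintype.sum_sigma' fun t i => if R.FacOpen ω t i then I.openCost t i else 0,
    ← Finset.sum_fiberwise Finset.univ
      (fun q : Node F => (⟨q.1, q.facility⟩ : (t : Fin k) × F t))]
  refine Finset.sum_le_sum fun x _ => ?_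
  obtain ⟨t, i⟩ := x
  split_ifs with h
  · obtain ⟨q, hq, hqx⟩ := h
    refine le_trans (le_of_eq ?_) (Finset.single_le_sum (fun q _ => hnn q)
      (Finset.mem_filter.2 ⟨Finset.mem_univ q, hqx⟩))
    rw [if_pos hq, one_mul]
    exact congrArg (fun y : (t : Fin k) × F t => I.openCost y.1 y.2) hqx.symm
  · exact Finset.sum_nonneg fun q _ => hnn q

theorem expect_facilityCost_le (hγ : 0 ≤ γ) :
    R.expect R.facilityCost ≤ γ * R.sol.facCost I := by
  refine (R.expect_mono hγ fun ω _ => R.facilityCost_le ω).trans ?_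
  rw [expect_sum, FracSol.facCost, Finset.mul_sum]
  refine Finset.sum_le_sum fun q _ => ?_
  rw [expect_mul_const, ← mul_assoc]
  exact mul_le_mul_of_nonneg_right ((R.expect_opened_le hγ q).trans (min_le_right _ _))
    (I.openCost_nonneg _ _)

end Run

/-! ### Distances along paths -/

section Distances

variable {k : ℕ} [NeZero k] {C : Type u} {F : Fin k → Type v} {X : Type w}
  [PseudoMetricSpace X] (I : Instance k C F X)

theorem Instance.pathCost_nonneg (j : C) (p : Path F) : 0 ≤ I.pathCost j p := by
  refine add_nonneg dist_nonneg (Finset.sum_nonneg fun t _ => ?_)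
  split_ifs
  exacts [dist_nonneg, le_rfl]

/-- Changing the client at the end of a path. -/
theorem Instance.pathCost_le (j j' : C) (p : Path F) :
    I.pathCost j p ≤ dist (I.clientLoc j) (I.clientLoc j') + I.pathCost j' p := by
  unfold Instance.pathCost
  linarith [dist_triangle (I.clientLoc j) (I.clientLoc j') (I.facLoc 0 (p 0))]

theorem Instance.dist_top_le (j : C) (p : Path F) :
    dist (I.clientLoc j) (I.facLoc (topLevel k) (p (topLevel k))) ≤ I.pathCost j p := by
  set f : Fin k → ℝ := fun t => if h : t.1 + 1 < k then
      dist (I.facLoc t (p t)) (I.facLoc ⟨t.1 + 1, h⟩ (p ⟨t.1 + 1, h⟩)) else 0 with hf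
  have hf0 : ∀ t, 0 ≤ f t := fun t => by
    simp only [hf]
    split_ifs
    exacts [dist_nonneg, le_rfl]
  have key : ∀ n (hn : n < k), dist (I.clientLoc j) (I.facLoc ⟨n, hn⟩ (p ⟨n, hn⟩))
      ≤ dist (I.clientLoc j) (I.facLoc 0 (p 0)) + ∑ t with t.1 < n, f t := by
    intro n
    induction n with
    | zero => intro hn; simp
    | succ n ih =>
      intro hn
      have hset : (Finset.univ.filter fun t : Fin k => t.1 < n + 1)
          = insert ⟨n, by omega⟩ (Finset.univ.filter fun t : Fin k => t.1 < n) := by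
        ext t
        simp only [Finset.mem_filter, Finset.mem_univ, true_and, Finset.mem_insert, Fin.ext_iff]
        omega
      rw [hset, Finset.sum_insert (by simp)]
      have h1 := ih (by omega)
      have h2 : f ⟨n, by omega⟩ = dist (I.facLoc ⟨n, by omega⟩ (p ⟨n, by omega⟩))
          (I.facLoc ⟨n + 1, hn⟩ (p ⟨n + 1, hn⟩)) := dif_pos hn
      have h3 := dist_triangle (I.clientLoc j) (I.facLoc ⟨n, by omega⟩ (p ⟨n, by omega⟩))
        (I.facLoc ⟨n + 1, hn⟩ (p ⟨n + 1, hn⟩))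
      linarith
  refine (key (k - 1) (topLevel k).2).trans (add_le_add le_rfl ?_)
  exact Finset.sum_le_sum_of_subset_of_nonneg (Finset.filter_subset _ _) fun t _ _ => hf0 t

/-- Two clients with paths to the same top-level facility are close to each other. -/
theorem Instance.dist_le_of_same_top (j j' : C) {p p' : Path F}
    (h : p (topLevel k) = p' (topLevel k)) :
    dist (I.clientLoc j) (I.clientLoc j') ≤ I.pathCost j p + I.pathCost j' p' := by
  have h1 := I.dist_top_le j p
  have h2 := I.dist_top_le j' p'
  rw [← h, dist_comm] at h2
  linarith [dist_triangle (I.clientLoc j) (I.facLoc (topLevel k) (p (topLevel k)))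
    (I.clientLoc j')]

end Distances

/-! ### Close paths -/

section Close

variable {k : ℕ} [NeZero k] {C : Type u} {F : Fin k → Type v} {X : Type w}
  [PseudoMetricSpace X] [∀ t, Fintype (F t)] {I : Instance k C F X} {j : C} {x : Path F → ℝ}
  {close : C → Path F → ℝ}

/-- The amount of the flow `x` of client `j` on paths of cost at most `s`. -/
def massUpTo (I : Instance k C F X) (j : C) (x : Path F → ℝ) (s : ℝ) : ℝ :=
  ∑ p with I.pathCost j p ≤ s, x p

theorem massUpTo_mono (hx : ∀ p, 0 ≤ x p) : Monotone (massUpTo I j x) := fun _ _ hst =>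
  Finset.sum_le_sum_of_subset_of_nonneg
    (Finset.monotone_filter_right _ fun _ _ h => le_trans h hst) fun p _ _ => hx p

theorem massUpTo_nonneg (hx : ∀ p, 0 ≤ x p) (s : ℝ) : 0 ≤ massUpTo I j x s :=
  Finset.sum_nonneg fun p _ => hx p

theorem massUpTo_add_sum_step (I : Instance k C F X) (j : C) (x : Path F → ℝ) (s : ℝ) :
    massUpTo I j x s + ∑ p, x p * (if s < I.pathCost j p then 1 else 0) = ∑ p, x p := by
  rw [massUpTo, Finset.sum_filter, ← Finset.sum_add_distrib]
  refine Finset.sum_congr rfl fun p _ => ?_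
  by_cases h : I.pathCost j p ≤ s
  · simp [h, not_lt.2 h]
  · simp [h, not_le.1 h]

theorem IsClosePart.cost_le_closeMax {p : Path F} (hp : 0 < close j p) :
    I.pathCost j p ≤ closeMax I close j := by
  refine le_csSup (Set.Finite.bddAbove ?_) ⟨p, hp, rfl⟩
  refine (Set.finite_range (I.pathCost j)).subset ?_
  rintro c ⟨p, -, rfl⟩
  exact ⟨p, rfl⟩

theorem IsClosePart.exists_cost_eq_closeMax (h : IsClosePart I j x (close j)) :
    ∃ p, 0 < close j p ∧ I.pathCost j p = closeMax I close j := by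
  have hne : {c | ∃ p, 0 < close j p ∧ c = I.pathCost j p}.Nonempty := by
    by_contra hempty
    have h0 : ∀ p, close j p = 0 := fun p =>
      le_antisymm (not_lt.1 fun hp => hempty ⟨_, p, hp, rfl⟩) (h.nonneg p)
    have := h.volume
    simp [h0] at this
  have hfin : {c | ∃ p, 0 < close j p ∧ c = I.pathCost j p}.Finite := by
    refine (Set.finite_range (I.pathCost j)).subset ?_
    rintro c ⟨p, -, rfl⟩
    exact ⟨p, rfl⟩
  obtain ⟨p, hp, hc⟩ := hne.csSup_mem hfin
  exact ⟨p, hp, hc.symm⟩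

theorem IsClosePart.closeAvg_nonneg (h : IsClosePart I j x (close j)) :
    0 ≤ closeAvg I close j :=
  Finset.sum_nonneg fun p _ => mul_nonneg (h.nonneg p) (I.pathCost_nonneg j p)

theorem IsClosePart.closeAvg_le_closeMax (h : IsClosePart I j x (close j)) :
    closeAvg I close j ≤ closeMax I close j := by
  calc closeAvg I close j ≤ ∑ p, close j p * closeMax I close j :=
        Finset.sum_le_sum fun p _ => by
          rcases (h.nonneg p).eq_or_lt with h0 | h0
          · simp [← h0]
          · exact mul_le_mul_of_nonneg_left (cost_le_closeMax h0) h0.le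
    _ = closeMax I close j := by rw [← Finset.sum_mul, h.volume, one_mul]

/-- The close paths carry one unit of flow. -/
theorem IsClosePart.one_le_massUpTo (h : IsClosePart I j x (close j)) {s : ℝ}
    (hs : closeMax I close j ≤ s) : 1 ≤ massUpTo I j x s := by
  rw [← h.volume, massUpTo, Finset.sum_filter]
  refine Finset.sum_le_sum fun p _ => ?_
  split_ifs with hp
  · exact h.le p
  · refine not_lt.1 fun h0 => hp ((cost_le_closeMax h0).trans hs)

/-- Below the maximal cost of a close path, all flow is close. -/
theorem IsClosePart.massUpTo_eq (h : IsClosePart I j x (close j)) {s : ℝ}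
    (hs : s < closeMax I close j) :
    1 - massUpTo I j x s = ∑ p, close j p * (if s < I.pathCost j p then 1 else 0) := by
  obtain ⟨p₀, hp₀, hc⟩ := h.exists_cost_eq_closeMax
  have h1 : massUpTo I j x s = massUpTo I j (close j) s :=
    Finset.sum_congr rfl fun p hp => by
      refine le_antisymm (not_lt.1 fun hlt => ?_) (h.le p)
      have h2 := h.cheapest p₀ p hp₀ hlt
      linarith [(Finset.mem_filter.1 hp).2]
  have h2 := massUpTo_add_sum_step I j (close j) s
  rw [h.volume] at h2
  linarith

end Close

/-! ### The cost of a client -/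

/-- The pathwise inequality behind the second way of using the token of the cluster center: `t` is
the cost of the token path for the center, `δ` the distance to the center, `o` the cost of the
cheapest own open path, and `o₀` this cost without the token, which is independent of `t`. -/
theorem token_detour_le {cost o o₀ t A δ : ℝ} (h1 : cost ≤ o) (h2 : cost ≤ δ + t) (h3 : o ≤ o₀)
    (h4 : min o₀ (δ - t) ≤ o) (hA : 0 ≤ A) :
    cost ≤ min o δ + (min o δ - min o (δ - A)) + (t - A) * (if δ < o₀ then 1 else 0) := by
  have hmono : min o (δ - A) ≤ min o δ := min_le_min le_rfl (by linarith)
  split_ifs with h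
  · rcases le_or_gt o δ with ho | ho
    · have h5 : δ - t ≤ o := by
        rcases min_le_iff.1 h4 with h5 | h5
        · linarith
        · exact h5
      rw [min_eq_left ho]
      rcases le_total o (δ - A) with h6 | h6
      · rw [min_eq_left h6]; linarith
      · rw [min_eq_right h6]; linarith
    · rw [min_eq_right ho.le, min_eq_right (by linarith)]
      linarith
  · rw [min_eq_left (by linarith : o ≤ δ)] at *
    linarith

namespace Run

variable {k : ℕ} [NeZero k] {C : Type u} {F : Fin k → Type v} {X : Type w}
  [PseudoMetricSpace X] [Fintype C] [∀ t, Fintype (F t)] {I : Instance k C F X} {γ : ℝ}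
  (R : Run I γ)

/-- The cost of the cheapest open path among those that carry flow of the client `j`, or of
rejecting `j` if this is cheaper. -/
def ownCost (τ : Node F → Prop) (b : Node F → Bool) (j : C) : ℝ :=
  (insert (I.penalty j)
    ((Finset.univ.filter fun p : Path F =>
      0 < R.xbar j p ∧ OpenBy τ b (Path.node p 0)).image (I.pathCost j))).min'
    (Finset.insert_nonempty _ _)

theorem le_ownCost_iff {τ : Node F → Prop} {b : Node F → Bool} {j : C} {s : ℝ} :
    s ≤ R.ownCost τ b j ↔ s ≤ I.penalty j ∧
      ∀ p, 0 < R.xbar j p → OpenBy τ b (Path.node p 0) → s ≤ I.pathCost j p := by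
  rw [ownCost, Finset.le_min'_iff, Finset.forall_mem_insert, Finset.forall_mem_image]
  simp

theorem lt_ownCost_iff {τ : Node F → Prop} {b : Node F → Bool} {j : C} {s : ℝ} :
    s < R.ownCost τ b j ↔ s < I.penalty j ∧
      ∀ p, 0 < R.xbar j p → OpenBy τ b (Path.node p 0) → s < I.pathCost j p := by
  rw [ownCost, Finset.lt_min'_iff, Finset.forall_mem_insert, Finset.forall_mem_image]
  simp

theorem ownCost_nonneg (τ : Node F → Prop) (b : Node F → Bool) (j : C) : 0 ≤ R.ownCost τ b j :=
  R.le_ownCost_iff.2 ⟨I.penalty_nonneg j, fun p _ _ => I.pathCost_nonneg j p⟩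

theorem ownCost_le_penalty (τ : Node F → Prop) (b : Node F → Bool) (j : C) :
    R.ownCost τ b j ≤ I.penalty j := (R.le_ownCost_iff.1 le_rfl).1

theorem clientCost_le_pathCost {ω : R.Outcome} (j : C) {p : Path F}
    (hp : OpenBy (R.Token ω.1) ω.2 (Path.node p 0)) : R.clientCost ω j ≤ I.pathCost j p := by
  refine Finset.min'_le _ _ (Finset.mem_insert_of_mem (Finset.mem_image_of_mem _
    (Finset.mem_filter.2 ⟨Finset.mem_univ _, fun t => ?_⟩)))
  exact ⟨Path.node p t, (R.opened_iff ω _).2 (hp.path (Token.father R) t), rfl⟩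

theorem clientCost_le_ownCost (ω : R.Outcome) (j : C) :
    R.clientCost ω j ≤ R.ownCost (R.Token ω.1) ω.2 j :=
  R.le_ownCost_iff.2 ⟨Finset.min'_le _ _ (Finset.mem_insert_self _ _),
    fun _ _ hp => R.clientCost_le_pathCost j hp⟩

/-- The path with the token of a center is always open. -/
theorem clientCost_le_token (ω : R.Outcome) (j : C) (c : {c // c ∈ R.centers}) :
    R.clientCost ω j
      ≤ dist (I.clientLoc j) (I.clientLoc c.1) + I.pathCost c.1 (ω.1 c) :=
  (R.clientCost_le_pathCost j (OpenBy.token _ ⟨c, rfl⟩)).trans (I.pathCost_le j c.1 _)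

/-- The amount by which the flow of client `j` on paths of cost at most `s`, together with the
rejection, falls short of `γ`. -/
def deficit (j : C) (s : ℝ) : ℝ :=
  if s < I.penalty j then max (γ - massUpTo I j (R.xbar j) s) 0 else 0

theorem deficit_nonneg (j : C) (s : ℝ) : 0 ≤ R.deficit j s := by
  unfold deficit
  split_ifs
  exacts [le_max_right _ _, le_rfl]

theorem xbar_nonneg (j : C) (p : Path F) : 0 ≤ R.xbar j p := R.xbar_recomputed.1.nonneg j p

theorem antitone_deficit (j : C) : Antitone (R.deficit j) := fun s t hst => by
  unfold deficit
  split_ifs with h1 h2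
  · exact max_le_max (sub_le_sub_left (massUpTo_mono (R.xbar_nonneg j) hst) γ) le_rfl
  · exact absurd (hst.trans_lt h1) h2
  · exact le_max_right _ _
  · exact le_rfl

/-- A client with `m` units of flow on cheap paths fails to have an open one among them with
probability at most `1 - F_k(m)`. -/
theorem expect_lt_ownCost_le (hγ : 0 ≤ γ) (j : C) (s : ℝ) :
    R.expect (fun ω => if s < R.ownCost (R.Token ω.1) ω.2 j then 1 else 0)
      ≤ tailBound (rate k) γ (R.deficit j) s := by
  by_cases hs : s < I.penalty j
  · set V : Path F → ℝ := fun p => if I.pathCost j p ≤ s then R.xbar j p else 0 with hVdef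
    have hV : ∀ p, 0 ≤ V p := fun p => by
      simp only [hVdef]
      split_ifs
      exacts [R.xbar_nonneg j p, le_rfl]
    have hVle : ∀ p, V p ≤ R.xbar j p := fun p => by
      simp only [hVdef]
      split_ifs
      exacts [le_rfl, R.xbar_nonneg j p]
    have hmass : ∑ p, V p = massUpTo I j (R.xbar j) s := by rw [massUpTo, Finset.sum_filter]
    obtain ⟨Q, hQ⟩ : ∃ Q : Path F → Prop, ∀ p, Q p ↔ 0 < R.xbar j p ∧ I.pathCost j p ≤ s :=
      ⟨_, fun _ => Iff.rfl⟩
    have h := (R.rounding hγ).prodExpect_no_path_le R.tokenWeight_nonneg R.sum_tokenWeight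
      (fun c c' p p' hp hp' h => R.eq_of_same_tree hp hp' h) (fun r hr => R.fatherProb_root hr) hV
      (fun q => by
        have hq : flow V q ≤ γ * R.sol.opening q :=
          (Finset.sum_le_sum fun p _ => hVle p).trans (R.xbar_recomputed.1.usage_le_opening j q)
        rcases le_total 1 (γ * R.sol.opening q) with h1 | h1
        · exact Or.inr (min_eq_left h1)
        · exact Or.inl (hq.trans (min_eq_right h1).ge))
      Q
      (fun p hp => by
        simp only [hVdef]
        split_ifs with hc
        · exact le_antisymm (not_lt.1 fun h0 => hp ((hQ p).2 ⟨h0, hc⟩)) (R.xbar_nonneg j p)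
        · rfl)
    rw [hmass] at h
    rw [expect_eq]
    refine le_trans (le_of_eq ?_) (h.trans ?_)
    · congr 1
      funext T
      congr 1
      funext b
      rw [← ite_not]
      refine if_congr ?_ rfl rfl
      rw [R.lt_ownCost_iff]
      simp only [hs, true_and]
      constructor
      · intro hall
        push Not at hall
        obtain ⟨p, hp, ho, hc⟩ := hall
        exact ⟨p, (hQ p).2 ⟨hp, hc⟩, ho⟩
      · rintro ⟨p, hpQ, ho⟩ hall
        obtain ⟨hp, hc⟩ := (hQ p).1 hpQ
        exact absurd (hall p hp ho) (not_lt.2 hc)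
    · rw [tailBound, ← Real.exp_add, deficit, if_pos hs]
      refine Real.exp_le_exp.2 ?_
      have h1 := mul_le_mul_of_nonneg_left
        (le_max_left (γ - massUpTo I j (R.xbar j) s) 0) (rate_mem k).1
      linarith
  · have h0 : ∀ ω : R.Outcome, ¬ s < R.ownCost (R.Token ω.1) ω.2 j := fun ω h =>
      hs (h.trans_le (R.ownCost_le_penalty _ _ j))
    simp only [h0, if_false]
    have : R.expect (fun _ => 0) = 0 := by simp [expect]
    rw [this]
    exact mul_nonneg (Real.exp_pos _).le (Real.exp_pos _).le

theorem expect_min_sub_min_le (hγ : 0 ≤ γ) (j : C) {a b : ℝ} (ha : 0 ≤ a) (hab : a ≤ b) :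
    R.expect (fun ω => min (R.ownCost (R.Token ω.1) ω.2 j) b
        - min (R.ownCost (R.Token ω.1) ω.2 j) a)
      ≤ ∫ s in a..b, tailBound (rate k) γ (R.deficit j) s :=
  sum_min_sub_min_le (R.prob_nonneg hγ) (fun ω => R.ownCost (R.Token ω.1) ω.2 j)
    (antitone_tailBound (rate_mem k).1 (R.antitone_deficit j)) ha hab
    fun s _ => R.expect_lt_ownCost_le hγ j s

/-- The share of client `j` in the fractional connection and penalty cost. -/
def fracCost (j : C) : ℝ := ∑ p, R.sol.conn j p * I.pathCost j p + R.sol.rej j * I.penalty j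

/-- The clients are recomputed independently, so each of them benefits. -/
theorem sum_xbar_cost_le (hγ : 0 ≤ γ) (j : C) :
    ∑ p, R.xbar j p * I.pathCost j p ≤ γ * ∑ p, R.sol.conn j p * I.pathCost j p := by
  have hf := R.sol_optimal.1
  have hx := R.xbar_recomputed.1
  set x' : C → Path F → ℝ := fun i => if i = j then fun p => γ * R.sol.conn i p else R.xbar i
    with hx'
  have hscaled : ScaledConn R.sol γ x' := by
    refine ⟨fun i p => ?_, fun i => ?_, fun i q => ?_⟩
    · by_cases h : i = j
      · simpa [hx', h] using mul_nonneg hγ (hf.conn_nonneg j p)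
      · simpa [hx', h] using hx.nonneg i p
    · by_cases h : i = j
      · have := mul_le_mul_of_nonneg_left (hf.served i) hγ
        simp only [hx', h, if_true, ← Finset.mul_sum] at this ⊢
        linarith
      · simpa [hx', h] using hx.served i
    · by_cases h : i = j
      · have := mul_le_mul_of_nonneg_left (hf.usage_le_opening i q) hγ
        simpa only [hx', h, if_true, ← Finset.mul_sum] using this
      · simpa [hx', h] using hx.usage_le_opening i q
  have h := R.xbar_recomputed.2 x' hscaled
  rw [← Finset.add_sum_erase _ _ (Finset.mem_univ j),
    ← Finset.add_sum_erase _ (fun i => ∑ p, x' i p * I.pathCost i p) (Finset.mem_univ j)] at h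
  have hrest : ∑ i ∈ Finset.univ.erase j, ∑ p, x' i p * I.pathCost i p
      = ∑ i ∈ Finset.univ.erase j, ∑ p, R.xbar i p * I.pathCost i p :=
    Finset.sum_congr rfl fun i hi => by simp [hx', Finset.ne_of_mem_erase hi]
  have hj : ∑ p, x' j p * I.pathCost j p = γ * ∑ p, R.sol.conn j p * I.pathCost j p := by
    simp only [hx', if_true, Finset.mul_sum, mul_assoc]
  rw [hrest, hj] at h
  linarith

/-- The flow of client `j` on paths of cost more than `s`, and its scaled rejection. -/
def remaining (j : C) (s : ℝ) : ℝ :=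
  ∑ p, R.xbar j p * (if s < I.pathCost j p then 1 else 0) + γ * R.sol.rej j

theorem antitone_remaining (j : C) : Antitone (R.remaining j) := fun _ _ hst =>
  add_le_add (antitone_sum_step (R.xbar_nonneg j) (I.pathCost j) hst) le_rfl

theorem le_massUpTo_add_remaining (j : C) (s : ℝ) :
    γ ≤ massUpTo I j (R.xbar j) s + R.remaining j s := by
  have h1 := massUpTo_add_sum_step I j (R.xbar j) s
  have h2 := R.xbar_recomputed.1.served j
  unfold remaining
  linarith

theorem rej_le_remaining (j : C) (s : ℝ) : γ * R.sol.rej j ≤ R.remaining j s := by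
  have : 0 ≤ ∑ p, R.xbar j p * (if s < I.pathCost j p then (1 : ℝ) else 0) :=
    Finset.sum_nonneg fun p _ => mul_nonneg (R.xbar_nonneg j p) (by split_ifs <;> norm_num)
  unfold remaining
  linarith

theorem remaining_nonneg (hγ : 0 ≤ γ) (j : C) (s : ℝ) : 0 ≤ R.remaining j s :=
  (mul_nonneg hγ (R.sol_optimal.1.rej_nonneg j)).trans (R.rej_le_remaining j s)

theorem integral_remaining_le (hγ : 0 ≤ γ) (j : C) {b : ℝ} (hb : 0 ≤ b)
    (hbp : b ≤ I.penalty j) : ∫ s in 0..b, R.remaining j s ≤ γ * R.fracCost j := by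
  unfold remaining
  rw [intervalIntegral.integral_add
    (antitone_sum_step (R.xbar_nonneg j) (I.pathCost j)).intervalIntegrable
    intervalIntegrable_const, ← sum_min_sub_min _ _ hb, intervalIntegral.integral_const,
    smul_eq_mul, fracCost, mul_add]
  have h1 : ∑ p, R.xbar j p * (min (I.pathCost j p) b - min (I.pathCost j p) 0)
      ≤ ∑ p, R.xbar j p * I.pathCost j p :=
    Finset.sum_le_sum fun p _ => mul_le_mul_of_nonneg_left (by
      rw [min_eq_right (I.pathCost_nonneg j p)]
      linarith [min_le_left (I.pathCost j p) b]) (R.xbar_nonneg j p)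
  have h2 := R.sum_xbar_cost_le hγ j
  have h3 := mul_le_mul_of_nonneg_right hbp (mul_nonneg hγ (R.sol_optimal.1.rej_nonneg j))
  linarith

theorem deficit_le_remaining (hγ : 0 ≤ γ) (j : C) (s : ℝ) :
    R.deficit j s ≤ R.remaining j s := by
  unfold deficit
  split_ifs
  · exact max_le (by linarith [R.le_massUpTo_add_remaining j s]) (R.remaining_nonneg hγ j s)
  · exact R.remaining_nonneg hγ j s

theorem integral_deficit_le (hγ : 0 ≤ γ) (j : C) {b : ℝ} (hb : 0 ≤ b) :
    ∫ s in 0..b, R.deficit j s ≤ γ * R.fracCost j := by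
  have hsmall : ∀ b, 0 ≤ b → b ≤ I.penalty j →
      ∫ s in 0..b, R.deficit j s ≤ γ * R.fracCost j := fun b hb hbp =>
    (intervalIntegral.integral_mono_on hb (R.antitone_deficit j).intervalIntegrable
      (R.antitone_remaining j).intervalIntegrable fun s _ =>
        R.deficit_le_remaining hγ j s).trans (R.integral_remaining_le hγ j hb hbp)
  rcases le_total b (I.penalty j) with h | h
  · exact hsmall b hb h
  · rw [← intervalIntegral.integral_add_adjacent_intervals (b := I.penalty j)
      (R.antitone_deficit j).intervalIntegrable (R.antitone_deficit j).intervalIntegrable]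
    have h0 : ∫ s in (I.penalty j)..b, R.deficit j s = 0 := by
      rw [intervalIntegral.integral_congr_Ioo_of_le h (f := R.deficit j) (g := fun _ => (0 : ℝ))
        fun s hs => (if_neg (not_lt.2 hs.1.le) : R.deficit j s = 0)]
      simp
    rw [h0, add_zero]
    exact hsmall _ (I.penalty_nonneg j) le_rfl

/-- The part of the first unit of flow of client `j` that is not on paths of cost at most `s`. -/
def shortfall (j : C) (s : ℝ) : ℝ := max (1 - massUpTo I j (R.xbar j) s) 0

theorem antitone_shortfall (j : C) : Antitone (R.shortfall j) := fun _ _ hst =>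
  max_le_max (sub_le_sub_left (massUpTo_mono (R.xbar_nonneg j) hst) 1) le_rfl

theorem tailBound_le_shortfall (hγ : 1 < γ) (j : C) {s : ℝ} (hs : s < I.penalty j) :
    tailBound (rate k) γ (R.deficit j) s
      ≤ Real.exp (-rate k) + (1 - Real.exp (-rate k)) * R.shortfall j s := by
  set m := massUpTo I j (R.xbar j) s with hm
  have hm0 : 0 ≤ m := massUpTo_nonneg (R.xbar_nonneg j) s
  obtain ⟨hc0, -⟩ := rate_mem k
  rw [tailBound, ← Real.exp_add, deficit, if_pos hs, shortfall, ← hm]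
  rcases le_total m 1 with h | h
  · rw [max_eq_left (by linarith : 0 ≤ γ - m), max_eq_left (by linarith : 0 ≤ 1 - m)]
    have h1 := exp_mul_le_chord hm0 h (-rate k)
    have e : -(rate k * γ) + rate k * (γ - m) = m * -rate k := by ring
    rw [e]
    linarith
  · rw [max_eq_right (by linarith : 1 - m ≤ 0), mul_zero, add_zero]
    refine Real.exp_le_exp.2 ?_
    rcases le_total 0 (γ - m) with h2 | h2
    · rw [max_eq_left h2]
      nlinarith
    · rw [max_eq_right h2]
      nlinarith

theorem expect_clientCost_le_integral (hγ : 0 ≤ γ) (j : C) {b : ℝ} (hb : 0 ≤ b)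
    (h : ∀ ω : R.Outcome, (∀ c, 0 < R.tokenWeight c (ω.1 c)) → R.clientCost ω j ≤ b) :
    R.expect (fun ω => R.clientCost ω j)
      ≤ ∫ s in 0..b, tailBound (rate k) γ (R.deficit j) s := by
  refine le_trans (R.expect_mono hγ fun ω hω => ?_) (R.expect_min_sub_min_le hγ j le_rfl hb)
  rw [min_eq_right (R.ownCost_nonneg _ _ j), sub_zero]
  exact le_min (R.clientCost_le_ownCost ω j) (h ω hω)

variable {ρ : ℝ}

/-- The bound for clients outside of `C_γ`, and for those with a penalty below the cost of some
close path. -/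
theorem expect_clientCost_le_of_free (hγ : 1 < γ) (j : C)
    (hfree : ∀ s, 0 ≤ s → s < I.penalty j → γ - 1 + R.shortfall j s ≤ R.remaining j s)
    (h1 : 1 + 2 * Real.exp (-(rate k * γ)) ≤ ρ)
    (h2 : γ * (Real.exp (-(rate k * γ)) + Real.exp (-rate k)) ≤ ρ * (γ - 1)) :
    R.expect (fun ω => R.clientCost ω j) ≤ ρ * R.fracCost j := by
  have hP := I.penalty_nonneg j
  have hγ0 : 0 ≤ γ := by linarith
  refine rejectable_bound (rate_mem k).1 hγ (R.antitone_deficit j) (R.antitone_shortfall j)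
    (fun s => le_max_right _ _)
    (fun s _ => max_le (by linarith [massUpTo_nonneg (I := I) (j := j) (R.xbar_nonneg j) s])
      zero_le_one) hP
    (fun s _ hs => R.tailBound_le_shortfall hγ j hs) ?_
    (R.expect_clientCost_le_integral hγ0 j hP fun ω _ =>
      (R.clientCost_le_ownCost ω j).trans (R.ownCost_le_penalty _ _ j)) h1 h2
  refine le_trans ?_ (R.integral_remaining_le hγ0 j hP le_rfl)
  have h3 := intervalIntegral.integral_mono_on_of_le_Ioo (μ := MeasureTheory.volume) hP
    (intervalIntegrable_const.add (R.antitone_shortfall j).intervalIntegrable)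
    (R.antitone_remaining j).intervalIntegrable fun s hs => hfree s hs.1.le hs.2
  rw [intervalIntegral.integral_add intervalIntegrable_const
    (R.antitone_shortfall j).intervalIntegrable, intervalIntegral.integral_const,
    smul_eq_mul] at h3
  linarith

/-- As long as at most one unit of flow has been used, what remains covers both what is missing to
one unit and another `γ - 1` units. -/
theorem free_of_massUpTo_le_one (j : C) {s : ℝ} (h : massUpTo I j (R.xbar j) s ≤ 1) :
    γ - 1 + R.shortfall j s ≤ R.remaining j s := by
  rw [shortfall, max_eq_left (by linarith)]
  linarith [R.le_massUpTo_add_remaining j s]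

/-- The token of the center `c` is independent of what is open without it. -/
theorem expect_token_mul (c : {c // c ∈ R.centers}) (j : C) (δ : ℝ) :
    R.expect (fun ω => (I.pathCost c.1 (ω.1 c) - closeAvg I R.close c.1)
      * (if δ < R.ownCost (fun q => ∃ c', c' ≠ c ∧ Path.Through (ω.1 c') q) ω.2 j
          then 1 else 0)) = 0 := by
  rw [expect_eq]
  simp only [prodExpect_const_mul]
  rw [prodExpect_update c (R.sum_tokenWeight c)]
  set G : ({c // c ∈ R.centers} → Path F) → ℝ := fun T => prodExpect (coinWeight R.coinProb)
    (fun b => if δ < R.ownCost (fun q => ∃ c', c' ≠ c ∧ Path.Through (T c') q) b j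
      then 1 else 0) with hG
  have hupd : ∀ T a, G (@Function.update _ _ (fun x y => Classical.propDecidable (x = y)) T c a)
      = G T := fun T a => by
    have : ∀ q : Node F, (∃ c', c' ≠ c ∧ Path.Through
        (@Function.update _ _ (fun x y => Classical.propDecidable (x = y)) T c a c') q) ↔
        ∃ c', c' ≠ c ∧ Path.Through (T c') q := fun q => exists_congr fun c' =>
      and_congr_right fun hne => by
        rw [show @Function.update _ _ (fun x y => Classical.propDecidable (x = y)) T c a c' = T c'
          from dif_neg hne]
    simp only [hG, this]
  have hself : ∀ (T : {c // c ∈ R.centers} → Path F) a,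
      @Function.update _ _ (fun x y => Classical.propDecidable (x = y)) T c a c = a :=
    fun T a => dif_pos rfl
  have hzero : ∑ p, R.tokenWeight c p * (I.pathCost c.1 p - closeAvg I R.close c.1) = 0 := by
    simp only [mul_sub, Finset.sum_sub_distrib]
    rw [← Finset.sum_mul, R.sum_tokenWeight, one_mul]
    exact sub_self _
  have hmain : ∀ T : {c // c ∈ R.centers} → Path F, ∑ a, R.tokenWeight c a *
      ((I.pathCost c.1 (@Function.update _ _ (fun x y => Classical.propDecidable (x = y)) T c a c)
        - closeAvg I R.close c.1)
        * G (@Function.update _ _ (fun x y => Classical.propDecidable (x = y)) T c a)) = 0 :=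
    fun T => by
      simp only [hupd, hself, ← mul_assoc]
      rw [← Finset.sum_mul, hzero, zero_mul]
  refine (congrArg (prodExpect R.tokenWeight) (funext hmain)).trans ?_
  exact prodExpect_const R.sum_tokenWeight 0

/-- A token of `c` opens a path of `j` only in a tree through which `j` is not far from `c`. -/
theorem min_ownCost_le (T : {c // c ∈ R.centers} → Path F) (b : Node F → Bool) (j : C)
    (c : {c // c ∈ R.centers}) :
    min (R.ownCost (fun q => ∃ c', c' ≠ c ∧ Path.Through (T c') q) b j)
        (dist (I.clientLoc j) (I.clientLoc c.1) - I.pathCost c.1 (T c))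
      ≤ R.ownCost (R.Token T) b j := by
  refine R.le_ownCost_iff.2 ⟨(min_le_left _ _).trans (R.ownCost_le_penalty _ _ j),
    fun p hp ho => ?_⟩
  by_cases h : OpenBy (fun q => ∃ c', c' ≠ c ∧ Path.Through (T c') q) b (Path.node p 0)
  · exact (min_le_left _ _).trans ((R.le_ownCost_iff.1 le_rfl).2 p hp h)
  · refine (min_le_right _ _).trans ?_
    have htop : p (topLevel k) = T c (topLevel k) := by
      by_contra hne
      refine h (ho.of_token_iff fun q hq hT => ?_)
      obtain ⟨c', hc'⟩ := hT
      refine ⟨c', ?_, hc'⟩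
      rintro rfl
      exact hne ((Path.through_node p 0).top_eq.symm.trans (hq.symm.trans hc'.top_eq))
    linarith [I.dist_le_of_same_top j c.1 htop]

theorem ownCost_le_ownCost (T : {c // c ∈ R.centers} → Path F) (b : Node F → Bool) (j : C)
    (c : {c // c ∈ R.centers}) :
    R.ownCost (R.Token T) b j ≤ R.ownCost (fun q => ∃ c', c' ≠ c ∧ Path.Through (T c') q) b j :=
  R.le_ownCost_iff.2 ⟨R.ownCost_le_penalty _ _ j, fun p hp ho =>
    (R.le_ownCost_iff.1 le_rfl).2 p hp (ho.mono fun _ ⟨c', _, hc'⟩ => ⟨c', hc'⟩)⟩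

/-- The bound for the clients that rely on the center of their cluster. -/
theorem expect_clientCost_le_of_clustered (hγ : 1 < γ) (hγ3 : γ ≤ 3) {j : C}
    (hj : j ∈ bigClients R.sol γ) (hM : closeMax I R.close j ≤ I.penalty j)
    (h1 : 1 + 2 * Real.exp (-(rate k * γ)) ≤ ρ)
    (h2 : γ * (Real.exp (-(rate k * γ)) + Real.exp (-rate k)) ≤ ρ * (γ - 1)) :
    R.expect (fun ω => R.clientCost ω j) ≤ ρ * R.fracCost j := by
  have hγ0 : 0 ≤ γ := by linarith
  have hcj := R.close_isClosePart j hj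
  obtain ⟨-, hnear, hcenter⟩ := R.center_clusterRun.spec.1 j hj
  set c : {c // c ∈ R.centers} := ⟨R.center j, R.center_mem hj⟩ with hc
  have hcc := R.isClosePart_of_mem_centers c.2
  have hM0 : 0 ≤ closeMax I R.close j := hcj.closeAvg_nonneg.trans hcj.closeAvg_le_closeMax
  have hint := (antitone_sum_step hcj.nonneg (I.pathCost j)).intervalIntegrable
    (μ := MeasureTheory.volume) (a := 0) (b := closeMax I R.close j)
  -- the average cost of the close paths is the integral of the close flow above each level
  have havg : ∫ s in 0..closeMax I R.close j,
      ∑ p, R.close j p * (if s < I.pathCost j p then (1 : ℝ) else 0) = closeAvg I R.close j := by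
    rw [← sum_min_sub_min _ _ hM0]
    refine Finset.sum_congr rfl fun p _ => ?_
    rcases (hcj.nonneg p).eq_or_lt with h0 | h0
    · simp [← h0]
    · rw [min_eq_left (IsClosePart.cost_le_closeMax h0), min_eq_right (I.pathCost_nonneg j p),
        sub_zero]
  have hδ : dist (I.clientLoc j) (I.clientLoc c.1)
      ≤ closeMax I R.close j + closeMax I R.close c.1 := by
    rcases hnear with h | ⟨p, p', hp, hp', htop⟩
    · have hMc : 0 ≤ closeMax I R.close c.1 :=
        hcc.closeAvg_nonneg.trans hcc.closeAvg_le_closeMax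
      have : I.clientLoc c.1 = I.clientLoc j := congrArg I.clientLoc h.symm
      rw [this, dist_self]
      exact add_nonneg hM0 hMc
    · have h3 := I.dist_le_of_same_top j c.1 (htop (topLevel k)
        (Nat.sub_add_cancel (NeZero.pos k))).symm
      exact h3.trans (add_le_add (IsClosePart.cost_le_closeMax hp')
        (IsClosePart.cost_le_closeMax hp))
  refine clustered_bound (rate_mem k).1 (rate_mem k).2 hγ hγ3 (R.antitone_deficit j)
    (R.deficit_nonneg j) hcj.closeAvg_nonneg hcj.closeAvg_le_closeMax (fun s hs => ?_)
    hcc.closeAvg_nonneg ?_ ?_ (fun b hb => R.integral_deficit_le hγ0 j hb) hδ hcenter ?_ ?_ h1 h2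
  · unfold deficit
    have := hcj.one_le_massUpTo hs
    split_ifs
    · exact max_le (by linarith) (by linarith)
    · linarith
  · have h3 := intervalIntegral.integral_mono_on_of_le_Ioo hM0
      (antitone_tailBound (γ := γ) (rate_mem k).1 (R.antitone_deficit j)).intervalIntegrable
      ((intervalIntegrable_const (c := Real.exp (-rate k))).add
        (hint.const_mul (1 - Real.exp (-rate k))))
      (fun s hs => by
        have h4 := R.tailBound_le_shortfall hγ j (hs.2.trans_le hM)
        have h5 := hcj.massUpTo_eq hs.2
        have h6 : 0 ≤ ∑ p, R.close j p * (if s < I.pathCost j p then (1 : ℝ) else 0) :=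
          Finset.sum_nonneg fun p _ => mul_nonneg (hcj.nonneg p) (by split_ifs <;> norm_num)
        rw [shortfall, h5, max_eq_left h6] at h4
        exact h4)
    rw [intervalIntegral.integral_add intervalIntegrable_const (hint.const_mul _),
      intervalIntegral.integral_const_mul, havg, intervalIntegral.integral_const,
      smul_eq_mul] at h3
    linarith
  · have h3 := intervalIntegral.integral_mono_on_of_le_Ioo hM0
      ((intervalIntegrable_const (c := γ - 1)).add hint)
      (R.antitone_deficit j).intervalIntegrable
      (fun s hs => by
        rw [← hcj.massUpTo_eq hs.2, deficit, if_pos (hs.2.trans_le hM)]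
        refine le_trans (le_of_eq ?_) (le_max_left _ _)
        ring)
    rw [intervalIntegral.integral_add intervalIntegrable_const hint, havg,
      intervalIntegral.integral_const, smul_eq_mul] at h3
    linarith
  · intro b hb hbM
    refine R.expect_clientCost_le_integral hγ0 j hb fun ω hω => ?_
    exact (R.clientCost_le_token ω j c).trans
      ((add_le_add le_rfl (IsClosePart.cost_le_closeMax (j := c.1) (hω c))).trans hbM)
  · intro hAδ
    set δ := dist (I.clientLoc j) (I.clientLoc c.1) with hδdef
    set A := closeAvg I R.close c.1 with hA
    have hA0 : 0 ≤ A := hcc.closeAvg_nonneg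
    calc R.expect (fun ω => R.clientCost ω j)
        ≤ R.expect (fun ω => ((min (R.ownCost (R.Token ω.1) ω.2 j) δ
            - min (R.ownCost (R.Token ω.1) ω.2 j) 0)
          + (min (R.ownCost (R.Token ω.1) ω.2 j) δ
            - min (R.ownCost (R.Token ω.1) ω.2 j) (δ - A)))
          + (I.pathCost c.1 (ω.1 c) - A)
            * (if δ < R.ownCost (fun q => ∃ c', c' ≠ c ∧ Path.Through (ω.1 c') q) ω.2 j
              then 1 else 0)) := by
          refine R.expect_mono hγ0 fun ω _ => ?_
          rw [min_eq_right (R.ownCost_nonneg (R.Token ω.1) ω.2 j), sub_zero]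
          exact token_detour_le (R.clientCost_le_ownCost ω j) (R.clientCost_le_token ω j c)
            (R.ownCost_le_ownCost ω.1 ω.2 j c) (R.min_ownCost_le ω.1 ω.2 j c) hA0
      _ ≤ _ := by
          rw [expect_add, expect_add, R.expect_token_mul c j δ, add_zero]
          exact add_le_add (R.expect_min_sub_min_le hγ0 j le_rfl (hA0.trans hAδ))
            (R.expect_min_sub_min_le hγ0 j (by linarith) (by linarith))

theorem expect_clientCost_le (hγ : 1 < γ) (hγ3 : γ ≤ 3) (j : C)
    (h1 : 1 + 2 * Real.exp (-(rate k * γ)) ≤ ρ)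
    (h2 : γ * (Real.exp (-(rate k * γ)) + Real.exp (-rate k)) ≤ ρ * (γ - 1)) :
    R.expect (fun ω => R.clientCost ω j) ≤ ρ * R.fracCost j := by
  by_cases hj : j ∈ bigClients R.sol γ
  · rcases le_or_gt (closeMax I R.close j) (I.penalty j) with hM | hM
    · exact R.expect_clientCost_le_of_clustered hγ hγ3 hj hM h1 h2
    · have hcj := R.close_isClosePart j hj
      refine R.expect_clientCost_le_of_free hγ j (fun s _ hs => ?_) h1 h2
      refine R.free_of_massUpTo_le_one j ?_
      have h3 := hcj.massUpTo_eq (hs.trans hM)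
      have h4 : 0 ≤ ∑ p, R.close j p * (if s < I.pathCost j p then (1 : ℝ) else 0) :=
        Finset.sum_nonneg fun p _ => mul_nonneg (hcj.nonneg p) (by split_ifs <;> norm_num)
      linarith
  · refine R.expect_clientCost_le_of_free hγ j (fun s _ _ => ?_) h1 h2
    rcases le_total (massUpTo I j (R.xbar j) s) 1 with h3 | h3
    · exact R.free_of_massUpTo_le_one j h3
    · have h4 : γ * (1 - R.sol.rej j) < 1 :=
        not_le.1 fun h => hj (Finset.mem_filter.2 ⟨Finset.mem_univ j, h⟩)
      rw [shortfall, max_eq_right (by linarith)]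
      linarith [R.rej_le_remaining j s]

end Run

end KLevelUFL

end


theorem mainTheorem2 {k : ℕ} [NeZero k] {C : Type*} [Fintype C]
    {F : Fin k → Type*} [∀ t, Fintype (F t)] {X : Type*} [PseudoMetricSpace X]
    (I : KLevelUFL.Instance k C F X) (γ : ℝ) (hγ1 : 1 < γ) (hγ3 : γ ≤ 3)
    (R : KLevelUFL.Run I γ) :
    R.expect (fun ω => ∑ j, R.clientCost ω j) ≤
        max (3 - 2 * KLevelUFL.pathProb k γ)
          ((2 - KLevelUFL.pathProb k γ - KLevelUFL.pathProb k 1) / (1 - 1 / γ)) *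
        (R.sol.connCost I + R.sol.penCost I) ∧
      R.expect R.facilityCost ≤ γ * R.sol.facCost I := by
  have hγ0 : 0 < γ := by linarith
  refine ⟨?_, R.expect_facilityCost_le hγ0.le⟩
  obtain ⟨n, hn⟩ := Nat.exists_eq_succ_of_ne_zero (NeZero.ne k)
  have hFγ : KLevelUFL.pathProb k γ ≤ 1 - Real.exp (-(KLevelUFL.rate k * γ)) := by
    rw [hn]
    exact KLevelUFL.pathProb_le n hγ0
  have hF1 : KLevelUFL.pathProb k 1 ≤ 1 - Real.exp (-KLevelUFL.rate k) := by
    have := KLevelUFL.pathProb_le n one_pos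
    rw [mul_one] at this
    rw [hn]
    exact this
  set ρ := max (3 - 2 * KLevelUFL.pathProb k γ)
    ((2 - KLevelUFL.pathProb k γ - KLevelUFL.pathProb k 1) / (1 - 1 / γ)) with hρ
  have h1 : 1 + 2 * Real.exp (-(KLevelUFL.rate k * γ)) ≤ ρ :=
    le_trans (by linarith) (le_max_left _ _)
  have h2 : γ * (Real.exp (-(KLevelUFL.rate k * γ)) + Real.exp (-KLevelUFL.rate k))
      ≤ ρ * (γ - 1) := by
    have h3 : (2 - KLevelUFL.pathProb k γ - KLevelUFL.pathProb k 1) / (1 - 1 / γ) ≤ ρ :=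
      le_max_right _ _
    have h4 : 0 < 1 - 1 / γ := by
      rw [sub_pos, div_lt_one hγ0]
      exact hγ1
    rw [div_le_iff₀ h4] at h3
    have h5 := mul_le_mul_of_nonneg_left h3 hγ0.le
    have h6 : γ * (ρ * (1 - 1 / γ)) = ρ * (γ - 1) := by field_simp
    rw [h6] at h5
    refine le_trans (mul_le_mul_of_nonneg_left ?_ hγ0.le) h5
    linarith
  rw [R.expect_sum]
  calc ∑ j, R.expect (fun ω => R.clientCost ω j) ≤ ∑ j, ρ * R.fracCost j :=
        Finset.sum_le_sum fun j _ => R.expect_clientCost_le hγ1 hγ3 j h1 h2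
    _ = ρ * (R.sol.connCost I + R.sol.penCost I) := by
        rw [← Finset.mul_sum, KLevelUFL.FracSol.connCost, KLevelUFL.FracSol.penCost,
          ← Finset.sum_add_distrib]
        rfl
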